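/- Let $\Gamma\subset\mathbb R^2$ be a simple closed curve that bounds a strictly convex domain, parametrised by a $1$-periodic $C^2$ map $\gamma:\mathbb R\to\mathbb R^2$ with $\gamma'\neq 0$ everywhere that descends to an embedding of $\mathbb R/\mathbb Z$. Let $R$ be the rotation of the plane over $\pi$, $S$ the reflection in the horizontal axis, $\mathbb D_2=\langle R,S\rangle$, and assume that $g(\Gamma)=\Gamma$ for all $g\in\mathbb D_2$. A billiard orbit is a sequence $z\in\Gamma^{\mathbb Z}$ with $z_{i+1}\ne z_i$ that satisfies the reflection law (angle of incidence equals angle of reflection) at every $z_i$. A lift of $z$ is a sequence $x\in\mathbb R^{\mathbb Z}$ with $\gamma(x_i)=z_i$ and $0<x_{i+1}-x_i<1$; $z$ has rotation number $\omega$ if $\lim_{i\to\pm\infty}x_i/i=\omega$. Write $a\prec b\prec c$ for points of $\Gamma$ if $a=\gamma(u)$, $b=\gamma(v)$, $c=\gamma(w)$ for some $u\le v\le w<u+1$; $z$ is Birkhoff if $z_i\prec z_j\prec z_k$ implies $z_{i+m}\prec z_{j+m}\prec z_{k+m}$ for all $i,j,k,m\in\mathbb Z$. A sequence $z$ is $\mathbb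 D_2$-symmetric if for every $h\in\mathbb D_2$ there is a $k\in\mathbb Z$ with $h(z_i)=z_{k+i}$ for all $i$, or a $k\in\mathbb Z$ with $h(z_i)=z_{k-i}$ for all $i$. A $\mathbb D_2$-symmetric sequence of even minimal period $p$ is of type I if $R(z_i)=z_{p/2+i}$ for all $i$ and for each reflection $\sigma\in\{S,RS\}$ there is a unique $0\le k<p$ with $\sigma(z_i)=z_{k-i}$ for all $i$ (the rotation acts time-preserving, the reflections act time-reversing). Let $Z$, with lift $X$, be a $2$-periodic, $\mathbb D_2$-symmetric Birkhoff billiard orbit. Then the segment length $L=\|Z_{i+1}-Z_i\|$ and the curvature $\kappa$ of $\Gamma$ at $Z_i$ do not depend on $i$. Moreover, if $s\ge 3$ is odd, $p=2s$ and $$\kappa L<2\cos^2\left(\frac{2\pi}{p}\right),$$ then there is a $\mathbb D_2$-symmetric non-Birkhoff periodic billiard orbit $z$ of type I, of minimal period $p$ and rotation number $\frac12$, which has a lift $x$ such that $x_{p+i}=x_i+s$ for all $i$ (and likewise $X_{p+i}=X_i+s$) and $x$ and $X$ cross exactly $4$ times per period $p$. That is, $x_i=X_i$ implies $(x_{i-1}-X_{i-1})(x_{i+1}-X_{i+1})<0$,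 and $4$ is the largest $k$ for which there are integers $i_0<i_1<\dots<i_k=i_0+p$ with $(x_{i_j}-X_{i_j})(x_{i_{j+1}}-X_{i_{j+1}})<0$ for $0\le j<k$. -/

import Mathlib

open Set Filter Topology

noncomputable section

namespace Billiard

/-! The Euclidean plane is `ℂ` with its real inner product structure. -/

/-- `γ` parametrises a billiard curve: it is `C²`, `1`-periodic, descends to an embedding of `ℝ/ℤ`,
and its image bounds a strictly convex domain. No orientation is prescribed. -/
structure IsBilliard (γ : ℝ → ℂ) : Prop where
  contDiff : ContDiff ℝ 2 γ
  periodic : ∀ x, γ (x + 1) = γ x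
  injective_mod_one : ∀ x y, γ x = γ y → ∃ m : ℤ, x - y = m
  deriv_ne_zero : ∀ x, deriv γ x ≠ 0
  strictly_convex : ∃ K : Set ℂ, IsCompact K ∧ StrictConvex ℝ K ∧ frontier K = range γ

/-- The counterclockwise rotation of the plane over the angle `2π/n`. -/
def rot (n : ℕ) : ℂ ≃ₗᵢ[ℝ] ℂ := rotation (Circle.exp (2 * Real.pi / n))

/-- The reflection of the plane in the horizontal axis. -/
def refl : ℂ ≃ₗᵢ[ℝ] ℂ := Complex.conjLIE

/-- The dihedral group generated by `rot n` and `refl`. -/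
def dihedral (n : ℕ) : Subgroup (ℂ ≃ₗᵢ[ℝ] ℂ) := Subgroup.closure {rot n, refl}

/-- The curve `Γ = range γ` is invariant under the dihedral group. -/
def IsSymmetricCurve (n : ℕ) (γ : ℝ → ℂ) : Prop :=
  ∀ g ∈ dihedral n, (fun w => g w) '' range γ = range γ

/-- The curvature of the curve at `γ x`, that is `|det (γ' x, γ'' x)| / ‖γ' x‖³`. -/
def curvature (γ : ℝ → ℂ) (x : ℝ) : ℝ :=
  |(deriv γ x).re * (deriv (deriv γ) x).im - (deriv γ x).im * (deriv (deriv γ) x).re| /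
    ‖deriv γ x‖ ^ 3

/-- A billiard sequence: consecutive points of the curve are distinct. -/
def IsBilliardSeq (γ : ℝ → ℂ) (z : ℤ → ℂ) : Prop :=
  (∀ i, z i ∈ range γ) ∧ ∀ i, z (i + 1) ≠ z i

/-- A billiard orbit: a billiard sequence in which at each point the angle of incidence
`∠(zᵢ - zᵢ₋₁, γ')` equals the angle of reflection `∠(γ', zᵢ₊₁ - zᵢ)`. -/
def IsBilliardOrbit (γ : ℝ → ℂ) (z : ℤ → ℂ) : Prop :=
  IsBilliardSeq γ z ∧
    ∀ (i : ℤ) (t : ℝ), γ t = z i →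
      InnerProductGeometry.angle (z i - z (i - 1)) (deriv γ t) =
        InnerProductGeometry.angle (deriv γ t) (z (i + 1) - z i)

/-- `x` is a lift of `z`, with increments in `(0, 1)`. -/
def IsLift (γ : ℝ → ℂ) (x : ℤ → ℝ) (z : ℤ → ℂ) : Prop :=
  (∀ i, γ (x i) = z i) ∧ ∀ i, 0 < x (i + 1) - x i ∧ x (i + 1) - x i < 1

/-- The cyclic order of three points on the curve. -/
def CyclicLE (γ : ℝ → ℂ) (a b c : ℂ) : Prop :=
  ∃ u v w : ℝ, γ u = a ∧ γ v = b ∧ γ w = c ∧ u ≤ v ∧ v ≤ w ∧ w < u + 1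

/-- The Birkhoff (well-ordered) property of a sequence of points on the curve. -/
def IsBirkhoff (γ : ℝ → ℂ) (z : ℤ → ℂ) : Prop :=
  ∀ i j k m : ℤ, CyclicLE γ (z i) (z j) (z k) → CyclicLE γ (z (i + m)) (z (j + m)) (z (k + m))

def HasPeriod (z : ℤ → ℂ) (p : ℕ) : Prop := ∀ i : ℤ, z (i + p) = z i

def HasMinimalPeriod (z : ℤ → ℂ) (p : ℕ) : Prop := IsLeast {k : ℕ | 0 < k ∧ HasPeriod z k} p

/-- `lim xᵢ / i = ω` as `i → ±∞`, for the lifts `x` of `z`. -/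
def HasRotationNumber (γ : ℝ → ℂ) (z : ℤ → ℂ) (ω : ℝ) : Prop :=
  ∀ x : ℤ → ℝ, IsLift γ x z →
    Tendsto (fun i : ℤ => x i / (i : ℝ)) atTop (𝓝 ω) ∧
    Tendsto (fun i : ℤ => x i / (i : ℝ)) atBot (𝓝 ω)

def IsTimePreserving (h : ℂ ≃ₗᵢ[ℝ] ℂ) (z : ℤ → ℂ) : Prop :=
  ∃ k : ℤ, ∀ i : ℤ, h (z i) = z (k + i)

def IsTimeReversing (h : ℂ ≃ₗᵢ[ℝ] ℂ) (z : ℤ → ℂ) : Prop :=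
  ∃ k : ℤ, ∀ i : ℤ, h (z i) = z (k - i)

/-- Every element of the dihedral group is a spatiotemporal symmetry of `z`. -/
def IsSymmetricSeq (n : ℕ) (z : ℤ → ℂ) : Prop :=
  ∀ h ∈ dihedral n, IsTimePreserving h z ∨ IsTimeReversing h z

/-- Type I, for a sequence of minimal period `p` whose symmetry group is `dihedral 2`: the rotation
acts time-preserving, as the shift over half a period, and each reflection acts time-reversing. -/
def IsTypeI (p : ℕ) (z : ℤ → ℂ) : Prop :=
  Even p ∧
  (∀ i : ℤ, rot 2 (z i) = z ((p / 2 : ℕ) + i)) ∧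
  ∀ σ ∈ ({refl, rot 2 * refl} : Set (ℂ ≃ₗᵢ[ℝ] ℂ)),
    ∃! k : ℤ, (0 ≤ k ∧ k < p) ∧ ∀ i : ℤ, σ (z i) = z (k - i)

/-- `(p, q)`-periodic real sequences. -/
def periodicSeqs (p q : ℕ) : Set (ℤ → ℝ) := {x | ∀ i : ℤ, x (p + i) = x i + q}

/-- Two real sequences without tangencies. -/
def IsTransverse (x y : ℤ → ℝ) : Prop :=
  ∀ i : ℤ, x i = y i → (x (i - 1) - y (i - 1)) * (x (i + 1) - y (i + 1)) < 0

/-- `x` and `y` are transverse `(p, q)`-periodic sequences that cross exactly `N` times per period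
(`N ≥ 1`): `N` is the largest `k` such that `x - y` changes sign along
`i₀ < i₁ < ⋯ < iₖ = i₀ + p` at each of the `k` steps. -/
def CrossExactly (p q : ℕ) (x y : ℤ → ℝ) (N : ℕ) : Prop :=
  x ∈ periodicSeqs p q ∧ y ∈ periodicSeqs p q ∧ IsTransverse x y ∧
  IsGreatest {k : ℕ | ∃ i : ℕ → ℤ, (∀ j < k, i j < i (j + 1)) ∧ i k = i 0 + p ∧
    ∀ j < k, (x (i j) - y (i j)) * (x (i (j + 1)) - y (i (j + 1))) < 0} N

end Billiard

end

/-!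
Why the theorem holds. The rotation over `π` exchanges the two points of `Z`, and the reflection in
the horizontal axis maps `Z 0` to one of them, so `Z` runs back and forth along one of the two
coordinate axes. An isometry of the plane brings it to the horizontal axis with the curve running
counterclockwise (`IsBisymmetric.exists_normalisation`). The domain being strictly convex, each axis
meets the curve in two antipodal points only, which cut it into four quadrant arcs (`IsFrame`). The
curvature at a point with vertical tangent is a limit that does not involve the parametrisation,
hence it agrees at the two ends of the axis (`IsFrame.curvature_antipode`).

Write `s = 2 m + 1`. The orbit is sought in the form `zⱼ = (-1)ʲ yⱼ`, where `y` has period `s`,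
satisfies `y₋ⱼ = conj yⱼ`, and has `y₁, …, yₘ` in the open first quadrant. The length of the segment
from `zⱼ` to `zⱼ₊₁` is then `‖yⱼ + yⱼ₊₁‖`, and half the length of the closed polygon is a continuous
function of the parameters of `y₁, …, yₘ` on the closed quadrant arc (`halfLength`). A maximum
exists by compactness. It lies in the interior (`IsFrame.exists_critical`):

* a vertex at the vertical end of the arc would force the preceding vertex to be there too, and
  finally `y₀`, which is on the horizontal axis;
* a vertex at the horizontal end would force its neighbours to be there too, so that `y` would be
  constant; but the second variation of the length at the constant sequence in the direction
  `sin (2 π j / s)` is positive precisely by the curvature condition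
  (`IsFrame.exists_halfLength_lt`), since this direction is an eigenvector of the second difference
  operator for the eigenvalue `2 cos (2 π / s)` and `1 + cos (2 π / s) = 2 cos² (2 π / p)`.

At an interior maximum the reflection law holds at `y₁, …, yₘ`, and the symmetries of the curve
carry it to all other vertices (`IsBisymmetric.deriv_eq_smul`, `IsFrame.exists_sequence`).

The remaining properties are read off from the signs of the heights of the `yⱼ`, which are the signs
of `xⱼ - Xⱼ`: these are positive in the first half and negative in the second half of each period
`s`, which makes four sign changes along `p = 2 s` (`isGreatest_signChanges`). Finally, for a
Birkhoff sequence the shift by two steps would be monotone on the points of the right arc; being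
periodic, it would be the identity there, contrary to the minimality of the period.
-/

noncomputable section

namespace Billiard

open scoped ComplexConjugate InnerProductSpace

/-! ### The dihedral group of order four -/

theorem rot_two_apply (w : ℂ) : rot 2 w = -w := by
  simp [rot, rotation_apply, Circle.coe_exp]

theorem refl_apply (w : ℂ) : refl w = conj w := rfl

theorem dihedral_two_apply {h : ℂ ≃ₗᵢ[ℝ] ℂ} (hh : h ∈ dihedral 2) :
    (∀ w, h w = w) ∨ (∀ w, h w = -w) ∨ (∀ w, h w = conj w) ∨ (∀ w, h w = -conj w) := by
  induction hh using Subgroup.closure_induction with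
  | mem x hx =>
    rcases hx with rfl | rfl
    · exact Or.inr (Or.inl rot_two_apply)
    · exact Or.inr (Or.inr (Or.inl refl_apply))
  | one => exact Or.inl fun _ => rfl
  | mul x y _ _ hx hy =>
    have hmul : ∀ w, (x * y) w = x (y w) := fun _ => rfl
    rcases hx with hx | hx | hx | hx <;> rcases hy with hy | hy | hy | hy <;>
      simp [hmul, hx, hy]
  | inv x _ hx =>
    have key : ∀ w v, x v = w → x⁻¹ w = v := fun w v h => by
      rw [← h]; exact x.symm_apply_apply v
    rcases hx with hx | hx | hx | hx
    · exact Or.inl fun w => key _ _ (by simp [hx])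
    · exact Or.inr (Or.inl fun w => key _ _ (by simp [hx]))
    · exact Or.inr (Or.inr (Or.inl fun w => key _ _ (by simp [hx])))
    · exact Or.inr (Or.inr (Or.inr fun w => key _ _ (by simp [hx])))

theorem rot_mem_dihedral (n : ℕ) : rot n ∈ dihedral n := Subgroup.subset_closure (by simp)

theorem refl_mem_dihedral (n : ℕ) : refl ∈ dihedral n := Subgroup.subset_closure (by simp)

/-! ### Transport along isometries of the plane -/

theorem IsBilliard.differentiable {γ : ℝ → ℂ} (h : IsBilliard γ) : Differentiable ℝ γ :=
  h.contDiff.differentiable (by norm_num)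

theorem IsBilliard.hasDerivAt {γ : ℝ → ℂ} (h : IsBilliard γ) (t : ℝ) :
    HasDerivAt γ (deriv γ t) t := (h.differentiable t).hasDerivAt

theorem deriv_isometry_comp (g : ℂ ≃ₗᵢ[ℝ] ℂ) (γ : ℝ → ℂ) :
    deriv (fun t => g (γ t)) = fun t => g (deriv γ t) := by
  funext t
  by_cases hd : DifferentiableAt ℝ γ t
  · exact ((g.toContinuousLinearEquiv : ℂ →L[ℝ] ℂ).hasFDerivAt.comp_hasDerivAt t
      hd.hasDerivAt).deriv
  · have hd' : ¬ DifferentiableAt ℝ (fun t => g (γ t)) t :=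
      fun h => hd (g.toContinuousLinearEquiv.comp_differentiableAt_iff.mp h)
    simp [deriv_zero_of_not_differentiableAt hd, deriv_zero_of_not_differentiableAt hd']

theorem IsBilliard.map {γ : ℝ → ℂ} (h : IsBilliard γ) (g : ℂ ≃ₗᵢ[ℝ] ℂ) :
    IsBilliard (fun t => g (γ t)) where
  contDiff := g.contDiff.comp h.contDiff
  periodic x := by rw [h.periodic]
  injective_mod_one x y hxy := h.injective_mod_one x y (g.injective hxy)
  deriv_ne_zero x := by
    rw [deriv_isometry_comp]
    simpa using h.deriv_ne_zero x
  strictly_convex := by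
    obtain ⟨K, hK, hc, hf⟩ := h.strictly_convex
    refine ⟨g '' K, hK.image g.continuous, ?_, ?_⟩
    · exact hc.is_linear_image g.toLinearEquiv.toLinearMap.isLinear g.toHomeomorph.isOpenMap
    · rw [← g.coe_toHomeomorph, ← Homeomorph.image_frontier, hf]
      exact (range_comp _ _).symm

theorem IsBilliardOrbit.map {γ : ℝ → ℂ} {z : ℤ → ℂ} (h : IsBilliardOrbit γ z)
    (g : ℂ ≃ₗᵢ[ℝ] ℂ) : IsBilliardOrbit (fun t => g (γ t)) (fun i => g (z i)) := by
  refine ⟨⟨fun i => ?_, fun i hi => h.1.2 i (g.injective hi)⟩, fun i t ht => ?_⟩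
  · obtain ⟨t, ht⟩ := h.1.1 i
    exact ⟨t, by simp [ht]⟩
  · rw [deriv_isometry_comp]
    simp only [← map_sub]
    have := h.2 i t (g.injective ht)
    rw [← g.coe_toLinearIsometry, g.toLinearIsometry.angle_map, g.toLinearIsometry.angle_map, this]

theorem isLift_map_iff {γ : ℝ → ℂ} {x : ℤ → ℝ} {z : ℤ → ℂ} (g : ℂ ≃ₗᵢ[ℝ] ℂ) :
    IsLift (fun t => g (γ t)) x (fun i => g (z i)) ↔ IsLift γ x z := by
  simp [IsLift]

theorem isBirkhoff_map_iff {γ : ℝ → ℂ} {z : ℤ → ℂ} (g : ℂ ≃ₗᵢ[ℝ] ℂ) :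
    IsBirkhoff (fun t => g (γ t)) (fun i => g (z i)) ↔ IsBirkhoff γ z := by
  simp [IsBirkhoff, CyclicLE]

theorem hasMinimalPeriod_map_iff {z : ℤ → ℂ} {p : ℕ} (g : ℂ ≃ₗᵢ[ℝ] ℂ) :
    HasMinimalPeriod (fun i => g (z i)) p ↔ HasMinimalPeriod z p := by
  simp [HasMinimalPeriod, HasPeriod]

theorem hasRotationNumber_map_iff {γ : ℝ → ℂ} {z : ℤ → ℂ} {ω : ℝ} (g : ℂ ≃ₗᵢ[ℝ] ℂ) :
    HasRotationNumber (fun t => g (γ t)) (fun i => g (z i)) ω ↔ HasRotationNumber γ z ω := by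
  simp [HasRotationNumber, isLift_map_iff]

theorem curvature_map (γ : ℝ → ℂ) (g : ℂ ≃ₗᵢ[ℝ] ℂ) (t : ℝ) :
    curvature (fun t => g (γ t)) t = curvature γ t := by
  have key : ∀ v w : ℂ, |(g v).re * (g w).im - (g v).im * (g w).re| =
      |v.re * w.im - v.im * w.re| := by
    intro v w
    obtain ⟨a, ha⟩ := linear_isometry_complex g
    have hn : (a : ℂ).re * (a : ℂ).re + (a : ℂ).im * (a : ℂ).im = 1 := by
      have := Circle.normSq_coe a
      rwa [Complex.normSq_apply] at this
    rcases ha with rfl | rfl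
    · congr 1
      simp only [rotation_apply, Complex.mul_re, Complex.mul_im]
      linear_combination (v.re * w.im - v.im * w.re) * hn
    · rw [← abs_neg]
      congr 1
      simp only [LinearIsometryEquiv.trans_apply, Complex.conjLIE_apply, Complex.conj_re,
        Complex.conj_im, rotation_apply, Complex.mul_re, Complex.mul_im]
      linear_combination (v.re * w.im - v.im * w.re) * hn
  simp only [curvature, deriv_isometry_comp, key, g.norm_map]

/-! ### Centrally symmetric strictly convex curves -/

theorem IsBilliard.continuous {γ : ℝ → ℂ} (h : IsBilliard γ) : Continuous γ :=
  h.contDiff.continuous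

theorem IsBilliard.add_intCast {γ : ℝ → ℂ} (h : IsBilliard γ) (t : ℝ) (n : ℤ) :
    γ (t + n) = γ t := by
  have : Function.Periodic γ 1 := h.periodic
  simpa using this.int_mul n t

theorem IsBilliard.exists_mem_Ico {γ : ℝ → ℂ} (h : IsBilliard γ) {w : ℂ} (hw : w ∈ range γ)
    (r : ℝ) : ∃ t ∈ Ico r (r + 1), γ t = w := by
  obtain ⟨t, rfl⟩ := hw
  have hp : Function.Periodic γ 1 := h.periodic
  obtain ⟨y, hy, e⟩ := hp.exists_mem_Ico zero_lt_one t r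
  exact ⟨y, hy, e.symm⟩

theorem IsBilliard.eq_of_abs_sub_lt {γ : ℝ → ℂ} (h : IsBilliard γ) {x y : ℝ} (e : γ x = γ y)
    (h1 : x < y + 1) (h2 : y < x + 1) : x = y := by
  obtain ⟨m, hm⟩ := h.injective_mod_one x y e
  have h3 : (m : ℝ) < 1 := by linarith
  have h4 : (-1 : ℝ) < m := by linarith
  have h5 : m < 1 := by exact_mod_cast h3
  have h6 : -1 < m := by exact_mod_cast h4
  have : m = 0 := by omega
  subst this
  simp at hm
  linarith

/-- The curve bounds a compact strictly convex set whose interior contains its centre of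
symmetry: the segment between two antipodal points of the curve runs through the interior. -/
theorem IsBilliard.exists_convex {γ : ℝ → ℂ} (h : IsBilliard γ)
    (hneg : ∀ w ∈ range γ, -w ∈ range γ) :
    ∃ K : Set ℂ, IsCompact K ∧ StrictConvex ℝ K ∧ frontier K = range γ ∧ (0 : ℂ) ∈ interior K := by
  obtain ⟨K, hK, hc, hf⟩ := h.strictly_convex
  refine ⟨K, hK, hc, hf, ?_⟩
  have hsub : range γ ⊆ K := hf ▸ hK.isClosed.frontier_subset
  obtain ⟨t, ht⟩ : ∃ t, γ t ≠ 0 := by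
    by_contra! hcon
    have := h.eq_of_abs_sub_lt (x := 0) (y := 1 / 2) (by rw [hcon, hcon]) (by norm_num)
      (by norm_num)
    norm_num at this
  have hne : γ t ≠ -γ t := fun e => ht (self_eq_neg.mp e)
  refine hc.openSegment_subset (hsub ⟨t, rfl⟩) (hsub (hneg _ ⟨t, rfl⟩)) hne ?_
  exact ⟨1 / 2, 1 / 2, by norm_num, by norm_num, by norm_num, by simp⟩

/-- A point strictly between two antipodal points of a strictly convex set is interior. -/
theorem smul_mem_interior {K : Set ℂ} (hc : StrictConvex ℝ K) {p : ℂ} (hp : p ∈ K) (hp' : -p ∈ K)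
    (h0 : p ≠ 0) {c : ℝ} (hc0 : 0 ≤ c) (hc1 : c < 1) : c • p ∈ interior K := by
  have hne : p ≠ -p := fun e => h0 (self_eq_neg.mp e)
  refine hc.openSegment_subset hp hp' hne ⟨(1 + c) / 2, (1 - c) / 2, by linarith, by linarith,
    by ring, ?_⟩
  module

/-- A curve that is invariant under both reflections in the coordinate axes. -/
structure IsBisymmetric (γ : ℝ → ℂ) : Prop extends IsBilliard γ where
  neg_mem : ∀ w ∈ range γ, -w ∈ range γ
  conj_mem : ∀ w ∈ range γ, conj w ∈ range γ

theorem IsBisymmetric.ne_zero {γ : ℝ → ℂ} (h : IsBisymmetric γ) (t : ℝ) : γ t ≠ 0 := by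
  obtain ⟨K, -, -, hf, h0⟩ := h.exists_convex h.neg_mem
  intro e
  exact disjoint_interior_frontier.le_bot ⟨h0, hf ▸ ⟨t, e⟩⟩

/-- If the midpoint of `w` and a second point of the curve lies on the axis through a point `p` of
the curve, it is not farther out than `p`. -/
theorem IsBisymmetric.le_of_midpoint {γ : ℝ → ℂ} (h : IsBisymmetric γ) {w w' p : ℂ}
    (hw : w ∈ range γ) (hw' : w' ∈ range γ) (hp : p ∈ range γ) {r : ℝ}
    (hr : w + w' = (2 * r) • p) : r ≤ 1 := by
  obtain ⟨K, hK, hc, hf, h0⟩ := h.exists_convex h.neg_mem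
  have hsub : range γ ⊆ K := hf ▸ hK.isClosed.frontier_subset
  by_contra! hlt
  have hp0 : p ≠ 0 := by
    obtain ⟨t, rfl⟩ := hp
    exact h.ne_zero t
  have hmid : ∀ {v v' : ℂ}, v ∈ range γ → v' ∈ range γ → (1 / 2 : ℝ) • (v + v') ∈ K := by
    intro v v' hv hv'
    rw [smul_add]
    exact hc.convex (hsub hv) (hsub hv') (by norm_num) (by norm_num) (by norm_num)
  have h1 : r • p ∈ K := by
    have := hmid hw hw'
    rw [hr, smul_smul] at this
    rwa [show (1 / 2 : ℝ) * (2 * r) = r by ring] at this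
  have h2 : -(r • p) ∈ K := by
    have := hmid (h.neg_mem _ hw) (h.neg_mem _ hw')
    rw [← neg_add, hr, smul_neg, smul_smul] at this
    rwa [show (1 / 2 : ℝ) * (2 * r) = r by ring] at this
  have h3 : p ∈ interior K := by
    have := smul_mem_interior hc h1 h2 (by simp [hp0]; linarith) (c := r⁻¹) (by positivity)
      (inv_lt_one_of_one_lt₀ hlt)
    rwa [smul_smul, inv_mul_cancel₀ (by linarith), one_smul] at this
  exact disjoint_interior_frontier.le_bot ⟨h3, hf ▸ hp⟩

theorem IsBisymmetric.re_le {γ : ℝ → ℂ} (h : IsBisymmetric γ) {s : ℝ} (hs : (γ s).im = 0)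
    (hs' : 0 < (γ s).re) (t : ℝ) : (γ t).re ≤ (γ s).re := by
  have := h.le_of_midpoint (w := γ t) (w' := conj (γ t)) (p := γ s) ⟨t, rfl⟩
    (h.conj_mem _ ⟨t, rfl⟩) ⟨s, rfl⟩ (r := (γ t).re / (γ s).re) (by
      apply Complex.ext
      · simp; field_simp; ring
      · simp [hs])
  rwa [div_le_one hs'] at this

theorem IsBisymmetric.im_le {γ : ℝ → ℂ} (h : IsBisymmetric γ) {s : ℝ} (hs : (γ s).re = 0)
    (hs' : 0 < (γ s).im) (t : ℝ) : (γ t).im ≤ (γ s).im := by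
  have := h.le_of_midpoint (w := γ t) (w' := -conj (γ t)) (p := γ s) ⟨t, rfl⟩
    (h.neg_mem _ (h.conj_mem _ ⟨t, rfl⟩)) ⟨s, rfl⟩ (r := (γ t).im / (γ s).im) (by
      apply Complex.ext
      · simp [hs]
      · simp; field_simp; ring)
  rwa [div_le_one hs'] at this

/-- The horizontal axis meets the curve in two antipodal points only. -/
theorem IsBisymmetric.eq_or_eq_neg_of_im {γ : ℝ → ℂ} (h : IsBisymmetric γ) {s t : ℝ}
    (hs : (γ s).im = 0) (ht : (γ t).im = 0) : γ t = γ s ∨ γ t = -γ s := by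
  have key : ∀ {s t : ℝ}, (γ s).im = 0 → |(γ t).re| ≤ |(γ s).re| := by
    intro s t hs
    obtain ⟨s', hs'⟩ := h.neg_mem _ ⟨s, rfl⟩
    have hre : (γ s).re ≠ 0 := fun e => h.ne_zero s (Complex.ext e hs)
    obtain ⟨t', ht'⟩ := h.neg_mem _ ⟨t, rfl⟩
    have ht2 : (γ t').re = -(γ t).re := by simp [ht']
    have hs2 : (γ s').re = -(γ s).re := by simp [hs']
    rcases lt_or_gt_of_ne hre with h1 | h1
    · have := h.re_le (s := s') (by simp [hs', hs]) (by simp [hs', h1])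
      rw [abs_of_neg h1]
      exact abs_le.mpr ⟨by linarith [this t'], by linarith [this t]⟩
    · have := h.re_le hs h1
      rw [abs_of_pos h1]
      exact abs_le.mpr ⟨by linarith [this t'], by linarith [this t]⟩
  rcases abs_eq_abs.mp (le_antisymm (key (t := t) hs) (key (t := s) ht)) with e | e
  · exact Or.inl (Complex.ext e (by rw [hs, ht]))
  · exact Or.inr (Complex.ext e (by simp [hs, ht]))

/-- The vertical axis meets the curve in two antipodal points only. -/
theorem IsBisymmetric.eq_or_eq_neg_of_re {γ : ℝ → ℂ} (h : IsBisymmetric γ) {s t : ℝ}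
    (hs : (γ s).re = 0) (ht : (γ t).re = 0) : γ t = γ s ∨ γ t = -γ s := by
  have key : ∀ {s t : ℝ}, (γ s).re = 0 → |(γ t).im| ≤ |(γ s).im| := by
    intro s t hs
    obtain ⟨s', hs'⟩ := h.neg_mem _ ⟨s, rfl⟩
    have him : (γ s).im ≠ 0 := fun e => h.ne_zero s (Complex.ext hs e)
    obtain ⟨t', ht'⟩ := h.neg_mem _ ⟨t, rfl⟩
    have ht2 : (γ t').im = -(γ t).im := by simp [ht']
    have hs2 : (γ s').im = -(γ s).im := by simp [hs']
    rcases lt_or_gt_of_ne him with h1 | h1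
    · have := h.im_le (s := s') (by simp [hs', hs]) (by simp [hs', h1])
      rw [abs_of_neg h1]
      exact abs_le.mpr ⟨by linarith [this t'], by linarith [this t]⟩
    · have := h.im_le hs h1
      rw [abs_of_pos h1]
      exact abs_le.mpr ⟨by linarith [this t'], by linarith [this t]⟩
  rcases abs_eq_abs.mp (le_antisymm (key (t := t) hs) (key (t := s) ht)) with e | e
  · exact Or.inl (Complex.ext (by rw [hs, ht]) e)
  · exact Or.inr (Complex.ext (by simp [hs, ht]) e)

/-- A symmetry of the curve maps tangent lines to tangent lines: a supporting line of the convex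
domain at a point of the curve is the tangent line there. -/
theorem IsBisymmetric.deriv_eq_smul {γ : ℝ → ℂ} (h : IsBisymmetric γ) (g : ℂ ≃ₗᵢ[ℝ] ℂ)
    (hg : ∀ w ∈ range γ, g.symm w ∈ range γ) {t t' : ℝ} (e : γ t = g (γ t')) :
    ∃ c : ℝ, deriv γ t = c • g (deriv γ t') := by
  obtain ⟨K, hK, hc, hf, h0⟩ := h.exists_convex h.neg_mem
  have hsub : range γ ⊆ K := hf ▸ hK.isClosed.frontier_subset
  obtain ⟨f, hfK⟩ := geometric_hahn_banach_open_point hc.convex.interior isOpen_interior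
    (x := γ t') fun hi => disjoint_interior_frontier.le_bot ⟨hi, hf ▸ ⟨t', rfl⟩⟩
  have hle : ∀ w ∈ K, f w ≤ f (γ t') := by
    intro w hw
    have hcl : w ∈ closure (interior K) := by
      rw [hc.convex.closure_interior_eq_closure_of_nonempty_interior ⟨0, h0⟩]
      exact subset_closure hw
    exact closure_minimal (fun v hv => (hfK v hv).le)
      (isClosed_le f.continuous continuous_const) hcl
  have hd1 : f (deriv γ t') = 0 := by
    have hd := f.hasFDerivAt.comp_hasDerivAt t' (h.hasDerivAt t')
    refine IsLocalMax.hasDerivAt_eq_zero (Eventually.of_forall fun r => ?_) hd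
    exact hle _ (hsub ⟨r, rfl⟩)
  have hd2 : f (g.symm (deriv γ t)) = 0 := by
    have hd := (f.comp (g.symm.toContinuousLinearEquiv : ℂ →L[ℝ] ℂ)).hasFDerivAt.comp_hasDerivAt t
      (h.hasDerivAt t)
    refine IsLocalMax.hasDerivAt_eq_zero (Eventually.of_forall fun r => ?_) hd
    simpa [e] using hle _ (hsub (hg _ ⟨r, rfl⟩))
  have hfw : ∀ w : ℂ, f w = w.re * f 1 + w.im * f Complex.I := by
    intro w
    have : w = w.re • (1 : ℂ) + w.im • Complex.I := by apply Complex.ext <;> simp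
    conv_lhs => rw [this]
    rw [map_add, map_smul, map_smul, smul_eq_mul, smul_eq_mul]
  have hpos : 0 < f (γ t') := by simpa using hfK 0 h0
  rw [hfw] at hd1 hd2 hpos
  set v := deriv γ t' with hv
  set v' := g.symm (deriv γ t) with hv'
  have hdet : v.re * v'.im - v.im * v'.re = 0 := by
    have e1 : f 1 * (v.re * v'.im - v.im * v'.re) = 0 := by
      linear_combination v'.im * hd1 - v.im * hd2
    have e2 : f Complex.I * (v.re * v'.im - v.im * v'.re) = 0 := by
      linear_combination -v'.re * hd1 + v.re * hd2
    rcases mul_eq_zero.mp e1 with h1 | h1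
    · rcases mul_eq_zero.mp e2 with h2 | h2
      · rw [h1, h2] at hpos; simp at hpos
      · exact h2
    · exact h1
  have hv0 : v.re ^ 2 + v.im ^ 2 ≠ 0 := by
    intro e0
    have h1 : v.re = 0 := by nlinarith [sq_nonneg v.re, sq_nonneg v.im]
    have h2 : v.im = 0 := by nlinarith [sq_nonneg v.re, sq_nonneg v.im]
    exact h.deriv_ne_zero t' (Complex.ext h1 h2)
  refine ⟨(v.re * v'.re + v.im * v'.im) / (v.re ^ 2 + v.im ^ 2), ?_⟩
  rw [← map_smul, ← g.symm_apply_eq, ← hv']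
  apply Complex.ext
  · rw [Complex.smul_re, smul_eq_mul]; field_simp; linear_combination -v.im * hdet
  · rw [Complex.smul_im, smul_eq_mul]; field_simp; linear_combination v.re * hdet

/-! ### One-sided first-order conditions -/

theorem deriv_nonpos_of_max_left {f : ℝ → ℝ} {f' a b : ℝ} (hf : HasDerivAt f f' a) (hab : a < b)
    (hmax : ∀ t ∈ Icc a b, f t ≤ f a) : f' ≤ 0 := by
  have h := (hasDerivAt_iff_tendsto_slope.mp hf).mono_left (nhdsGT_le_nhdsNE a)
  refine le_of_tendsto h ?_
  filter_upwards [Ioo_mem_nhdsGT hab] with t ht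
  rw [slope_def_field]
  exact div_nonpos_of_nonpos_of_nonneg (by linarith [hmax t ⟨ht.1.le, ht.2.le⟩])
    (by linarith [ht.1])

theorem deriv_nonneg_of_max_right {f : ℝ → ℝ} {f' a b : ℝ} (hf : HasDerivAt f f' b) (hab : a < b)
    (hmax : ∀ t ∈ Icc a b, f t ≤ f b) : 0 ≤ f' := by
  have h := (hasDerivAt_iff_tendsto_slope.mp hf).mono_left (nhdsLT_le_nhdsNE b)
  refine ge_of_tendsto h ?_
  filter_upwards [Ioo_mem_nhdsLT hab] with t ht
  rw [slope_def_field]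
  exact div_nonneg_of_nonpos (by linarith [hmax t ⟨ht.1.le, ht.2.le⟩])
    (by linarith [ht.2])

theorem pos_of_ne_zero_on {f : ℝ → ℝ} (hf : Continuous f) {s : Set ℝ} (hs : s.OrdConnected)
    (h0 : ∀ t ∈ s, f t ≠ 0) {a b : ℝ} (ha : a ∈ s) (hb : b ∈ s) (hpos : 0 < f a) : 0 < f b := by
  by_contra! hle
  have : (0 : ℝ) ∈ uIcc (f a) (f b) := by rw [uIcc_of_ge (by linarith)]; exact ⟨hle, hpos.le⟩
  obtain ⟨t, ht, e⟩ := intermediate_value_uIcc hf.continuousOn this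
  exact h0 t (hs.uIcc_subset ha hb ht) e

theorem hasDerivAt_re {γ : ℝ → ℂ} {v : ℂ} {t : ℝ} (h : HasDerivAt γ v t) :
    HasDerivAt (fun r => (γ r).re) v.re t :=
  Complex.reCLM.hasFDerivAt.comp_hasDerivAt t h

theorem hasDerivAt_im {γ : ℝ → ℂ} {v : ℂ} {t : ℝ} (h : HasDerivAt γ v t) :
    HasDerivAt (fun r => (γ r).im) v.im t :=
  Complex.imCLM.hasFDerivAt.comp_hasDerivAt t h

/-! ### The four quadrants of a bisymmetric curve -/

/-- The parameters `T₀ < q < T₁ < q' < T₀ + 1` of the four points in which a bisymmetric curve,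
run through counterclockwise from a point of the positive horizontal axis, meets the axes,
together with the signs of the coordinates in between. -/
structure IsFrame (γ : ℝ → ℂ) (T₀ q T₁ q' : ℝ) : Prop extends IsBisymmetric γ where
  lt₁ : T₀ < q
  lt₂ : q < T₁
  lt₃ : T₁ < q'
  lt₄ : q' < T₀ + 1
  im_zero : (γ T₀).im = 0
  re_pos_zero : 0 < (γ T₀).re
  antipode : γ T₁ = -γ T₀
  re_q : (γ q).re = 0
  im_q : 0 < (γ q).im
  antipode_q : γ q' = -γ q
  re_pos : ∀ t ∈ Ioo (q' - 1) q, 0 < (γ t).re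
  re_neg : ∀ t ∈ Ioo q q', (γ t).re < 0
  im_pos : ∀ t ∈ Ioo T₀ T₁, 0 < (γ t).im
  im_neg : ∀ t ∈ Ioo T₁ (T₀ + 1), (γ t).im < 0

theorem IsBisymmetric.exists_isFrame {γ : ℝ → ℂ} (h : IsBisymmetric γ) {T₀ T₁ : ℝ} (h1 : T₀ < T₁)
    (h2 : T₁ < T₀ + 1) (him : (γ T₀).im = 0) (hre : 0 < (γ T₀).re) (hanti : γ T₁ = -γ T₀)
    (hup : ∃ t ∈ Ioo T₀ T₁, 0 < (γ t).im) : ∃ q q', IsFrame γ T₀ q T₁ q' := by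
  have hcre : Continuous fun t => (γ t).re := Complex.continuous_re.comp h.continuous
  have hcim : Continuous fun t => (γ t).im := Complex.continuous_im.comp h.continuous
  have hper : γ (T₀ + 1) = γ T₀ := h.periodic T₀
  have hne1 : ∀ t ∈ Ioo T₀ T₁, (γ t).im ≠ 0 := by
    intro t ht e
    rcases h.eq_or_eq_neg_of_im him e with e | e
    · exact ht.1.ne' (h.eq_of_abs_sub_lt e (by linarith [ht.2]) (by linarith [ht.1]))
    · rw [← hanti] at e
      exact ht.2.ne (h.eq_of_abs_sub_lt e (by linarith [ht.2]) (by linarith [ht.1]))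
  have hne2 : ∀ t ∈ Ioo T₁ (T₀ + 1), (γ t).im ≠ 0 := by
    intro t ht e
    rcases h.eq_or_eq_neg_of_im him e with e | e
    · rw [← hper] at e
      exact ht.2.ne (h.eq_of_abs_sub_lt e (by linarith [ht.2]) (by linarith [ht.1]))
    · rw [← hanti] at e
      exact ht.1.ne' (h.eq_of_abs_sub_lt e (by linarith [ht.2]) (by linarith [ht.1]))
  obtain ⟨u, hu, hupos⟩ := hup
  have hpos1 : ∀ t ∈ Ioo T₀ T₁, 0 < (γ t).im := fun t ht =>
    pos_of_ne_zero_on hcim ordConnected_Ioo hne1 hu ht hupos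
  -- the mirror image of an upper point lies on the other arc
  obtain ⟨u', hu', hconj⟩ := h.exists_mem_Ico (h.conj_mem _ ⟨u, rfl⟩) T₀
  have huim : (γ u').im < 0 := by rw [hconj]; simpa using hupos
  have hu'mem : u' ∈ Ioo T₁ (T₀ + 1) := by
    refine ⟨?_, hu'.2⟩
    by_contra! hle
    rcases eq_or_lt_of_le hu'.1 with e | e
    · rw [← e, him] at huim; exact huim.false
    · rcases eq_or_lt_of_le hle with e' | e'
      · rw [e', hanti] at huim; simp [him] at huim
      · exact (hpos1 u' ⟨e, e'⟩).not_gt huim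
  have hneg1 : ∀ t ∈ Ioo T₁ (T₀ + 1), (γ t).im < 0 := fun t ht => by
    have := pos_of_ne_zero_on (f := fun t => -(γ t).im) hcim.neg ordConnected_Ioo
      (fun t ht => neg_ne_zero.mpr (hne2 t ht)) hu'mem ht (by simpa using huim)
    simpa using this
  have hreT1 : (γ T₁).re < 0 := by rw [hanti]; simpa using hre
  have hreT0' : 0 < (γ (T₀ + 1)).re := by rw [hper]; exact hre
  obtain ⟨q, hq, hq0⟩ : ∃ q ∈ Ioo T₀ T₁, (γ q).re = 0 := by
    obtain ⟨q, hq, e⟩ := intermediate_value_Icc' h1.le hcre.continuousOn ⟨hreT1.le, hre.le⟩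
    refine ⟨q, ⟨lt_of_le_of_ne hq.1 ?_, lt_of_le_of_ne hq.2 ?_⟩, e⟩
    · rintro rfl; exact hre.ne' e
    · rintro rfl; exact hreT1.ne e
  obtain ⟨q', hq', hq0'⟩ : ∃ q ∈ Ioo T₁ (T₀ + 1), (γ q).re = 0 := by
    obtain ⟨q, hq, e⟩ := intermediate_value_Icc h2.le hcre.continuousOn ⟨hreT1.le, hreT0'.le⟩
    refine ⟨q, ⟨lt_of_le_of_ne hq.1 ?_, lt_of_le_of_ne hq.2 ?_⟩, e⟩
    · rintro rfl; exact hreT1.ne e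
    · rintro rfl; exact hreT0'.ne' e
  have hqpos := hpos1 q hq
  have hqneg := hneg1 q' hq'
  have hanti' : γ q' = -γ q := by
    rcases h.eq_or_eq_neg_of_re hq0 hq0' with e | e
    · rw [e] at hqneg; linarith
    · exact e
  have hrene : ∀ t ∈ Icc T₀ (T₀ + 1), (γ t).re = 0 → t = q ∨ t = q' := by
    intro t ht e
    rcases h.eq_or_eq_neg_of_re hq0 e with e | e
    · exact Or.inl (h.eq_of_abs_sub_lt e (by linarith [ht.2, hq.1]) (by linarith [ht.1, hq.2]))
    · rw [← hanti'] at e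
      exact Or.inr (h.eq_of_abs_sub_lt e (by linarith [ht.2, hq'.1]) (by linarith [ht.1, hq'.2]))
  have hR1 : ∀ t ∈ Ico T₀ q, 0 < (γ t).re := fun t ht =>
    pos_of_ne_zero_on (f := fun t => (γ t).re) hcre ordConnected_Ico (s := Ico T₀ q)
      (fun r hr e => by
        rcases hrene r ⟨hr.1, by linarith [hr.2, hq.2]⟩ e with e | e <;>
          linarith [hr.2, hq.2, hq'.1]) ⟨le_rfl, hq.1⟩ ht hre
  have hR2 : ∀ t ∈ Ioc q' (T₀ + 1), 0 < (γ t).re := fun t ht =>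
    pos_of_ne_zero_on (f := fun t => (γ t).re) hcre ordConnected_Ioc (s := Ioc q' (T₀ + 1))
      (fun r hr e => by
        rcases hrene r ⟨by linarith [hr.1, hq'.1], hr.2⟩ e with e | e <;>
          linarith [hr.1, hq.2, hq'.1]) ⟨hq'.2, le_rfl⟩ ht hreT0'
  have hR3 : ∀ t ∈ Ioo q q', (γ t).re < 0 := fun t ht => by
    have := pos_of_ne_zero_on (f := fun t => -(γ t).re) hcre.neg ordConnected_Ioo (s := Ioo q q')
      (fun r hr e => by
        rcases hrene r ⟨by linarith [hr.1, hq.1], by linarith [hr.2, hq'.2]⟩ (neg_eq_zero.mp e)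
          with e | e <;> linarith [hr.1, hr.2]) ⟨hq.2, hq'.1⟩ ht (by simpa using hreT1)
    simpa using this
  refine ⟨q, q', ⟨h, hq.1, hq.2, hq'.1, hq'.2, him, hre, hanti, hq0, hqpos, hanti', fun t ht => ?_,
    hR3, hpos1, hneg1⟩⟩
  rcases le_or_gt T₀ t with h0 | h0
  · exact hR1 t ⟨h0, ht.2⟩
  · rw [← h.periodic t]
    exact hR2 _ ⟨by linarith [ht.1], by linarith⟩

namespace IsFrame

variable {γ : ℝ → ℂ} {T₀ q T₁ q' : ℝ}

theorem re_le (F : IsFrame γ T₀ q T₁ q') (t : ℝ) : (γ t).re ≤ (γ T₀).re :=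
  F.toIsBisymmetric.re_le F.im_zero F.re_pos_zero t

theorem im_le (F : IsFrame γ T₀ q T₁ q') (t : ℝ) : (γ t).im ≤ (γ q).im :=
  F.toIsBisymmetric.im_le F.re_q F.im_q t

theorem deriv_T₀_re (F : IsFrame γ T₀ q T₁ q') : (deriv γ T₀).re = 0 :=
  IsLocalMax.hasDerivAt_eq_zero (Eventually.of_forall F.re_le) (hasDerivAt_re (F.hasDerivAt T₀))

theorem deriv_q_im (F : IsFrame γ T₀ q T₁ q') : (deriv γ q).im = 0 :=
  IsLocalMax.hasDerivAt_eq_zero (Eventually.of_forall F.im_le) (hasDerivAt_im (F.hasDerivAt q))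

theorem re_nonneg (F : IsFrame γ T₀ q T₁ q') {t : ℝ} (ht : t ∈ Icc T₀ q) : 0 ≤ (γ t).re := by
  rcases eq_or_lt_of_le ht.2 with e | e
  · rw [e, F.re_q]
  · exact (F.re_pos t ⟨by linarith [ht.1, F.lt₄], e⟩).le

theorem im_nonneg (F : IsFrame γ T₀ q T₁ q') {t : ℝ} (ht : t ∈ Icc T₀ q) : 0 ≤ (γ t).im := by
  rcases eq_or_lt_of_le ht.1 with e | e
  · rw [← e, F.im_zero]
  · exact (F.im_pos t ⟨e, by linarith [ht.2, F.lt₂]⟩).le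

theorem eq_q_of_re (F : IsFrame γ T₀ q T₁ q') {t : ℝ} (ht : t ∈ Icc T₀ q) (h0 : (γ t).re ≤ 0) :
    t = q := by
  by_contra hne
  exact (F.re_pos t ⟨by linarith [ht.1, F.lt₄], lt_of_le_of_ne ht.2 hne⟩).not_ge h0

theorem eq_T₀_of_im (F : IsFrame γ T₀ q T₁ q') {t : ℝ} (ht : t ∈ Icc T₀ q) (h0 : (γ t).im ≤ 0) :
    t = T₀ := by
  by_contra hne
  exact (F.im_pos t ⟨lt_of_le_of_ne ht.1 (Ne.symm hne), by linarith [ht.2, F.lt₂]⟩).not_ge h0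

theorem deriv_T₀_im (F : IsFrame γ T₀ q T₁ q') : 0 < (deriv γ T₀).im := by
  refine lt_of_le_of_ne ?_ fun e => F.deriv_ne_zero T₀ (Complex.ext F.deriv_T₀_re e.symm)
  have := deriv_nonpos_of_max_left (hasDerivAt_im (F.hasDerivAt T₀)).neg F.lt₁ fun t ht => by
    simpa [F.im_zero] using F.im_nonneg ht
  linarith

theorem deriv_q_re (F : IsFrame γ T₀ q T₁ q') : (deriv γ q).re < 0 := by
  refine lt_of_le_of_ne ?_ fun e => F.deriv_ne_zero q (Complex.ext e F.deriv_q_im)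
  have := deriv_nonneg_of_max_right (hasDerivAt_re (F.hasDerivAt q)).neg F.lt₁ fun t ht => by
    simpa [F.re_q] using F.re_nonneg ht
  linarith

theorem exists_right (F : IsFrame γ T₀ q T₁ q') {w : ℂ} (hw : w ∈ range γ) (h0 : 0 < w.re) :
    ∃ t ∈ Ioo (q' - 1) q, γ t = w := by
  obtain ⟨t, ht, rfl⟩ := F.exists_mem_Ico hw (q' - 1)
  refine ⟨t, ⟨lt_of_le_of_ne ht.1 ?_, ?_⟩, rfl⟩
  · rintro rfl
    have := F.periodic (q' - 1)
    rw [sub_add_cancel, F.antipode_q] at this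
    rw [← this] at h0
    simp [F.re_q] at h0
  · by_contra! hle
    rcases eq_or_lt_of_le hle with e | e
    · rw [← e, F.re_q] at h0; exact h0.false
    · exact (F.re_neg t ⟨e, by linarith [ht.2]⟩).not_gt h0

theorem exists_left (F : IsFrame γ T₀ q T₁ q') {w : ℂ} (hw : w ∈ range γ) (h0 : w.re < 0) :
    ∃ t ∈ Ioo q q', γ t = w := by
  obtain ⟨t, ht, rfl⟩ := F.exists_mem_Ico hw (q' - 1)
  refine ⟨t, ⟨?_, by linarith [ht.2]⟩, rfl⟩
  by_contra! hle
  rcases eq_or_lt_of_le hle with e | e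
  · rw [e, F.re_q] at h0; exact h0.false
  · rcases eq_or_lt_of_le ht.1 with e' | e'
    · have := F.periodic (q' - 1)
      rw [sub_add_cancel, F.antipode_q] at this
      rw [← e', ← this] at h0
      simp [F.re_q] at h0
    · exact (F.re_pos t ⟨e', e⟩).not_gt h0

end IsFrame

/-! ### Curvature at the ends of the axis -/

/-- The second-order Taylor coefficient as a limit, at a point where the first derivative
vanishes. -/
theorem tendsto_div_sq_of_deriv_eq_zero {f f' : ℝ → ℝ} {f'' a : ℝ}
    (hf : ∀ t, HasDerivAt f (f' t) t) (h0 : f' a = 0) (hf' : HasDerivAt f' f'' a) :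
    Tendsto (fun t => (f t - f a) / (t - a) ^ 2) (𝓝[≠] a) (𝓝 (f'' / 2)) := by
  have hs : Tendsto (fun t => f' t / (2 * (t - a))) (𝓝[≠] a) (𝓝 (f'' / 2)) := by
    have := (hasDerivAt_iff_tendsto_slope.mp hf').div_const 2
    refine this.congr fun t => ?_
    rw [slope_def_field, h0, sub_zero, div_div, mul_comm]
  refine HasDerivAt.lhopital_zero_nhdsNE (f' := f') (g' := fun t => 2 * (t - a))
    (Eventually.of_forall fun t => (hf t).sub_const _) (Eventually.of_forall fun t => ?_)
    ?_ ?_ ?_ hs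
  · have := ((hasDerivAt_id t).sub_const a).pow 2
    simp only [Nat.cast_ofNat, Nat.add_one_sub_one, pow_one, mul_one] at this
    exact this
  · filter_upwards [self_mem_nhdsWithin] with t ht
    simpa [sub_eq_zero] using ht
  · have : Tendsto (fun t => f t - f a) (𝓝 a) (𝓝 (f a - f a)) :=
      ((hf a).continuousAt.tendsto).sub_const _
    rw [sub_self] at this
    exact this.mono_left nhdsWithin_le_nhds
  · have : Tendsto (fun t : ℝ => (t - a) ^ 2) (𝓝 a) (𝓝 ((a - a) ^ 2)) :=
      (by fun_prop : Continuous fun t : ℝ => (t - a) ^ 2).tendsto a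
    rw [sub_self, zero_pow two_ne_zero] at this
    exact this.mono_left nhdsWithin_le_nhds

theorem IsBilliard.hasDerivAt_deriv {γ : ℝ → ℂ} (h : IsBilliard γ) (t : ℝ) :
    HasDerivAt (deriv γ) (deriv (deriv γ) t) t := by
  have h1 : ContDiff ℝ 1 (deriv γ) := by
    have := h.contDiff
    rw [show (2 : WithTop ℕ∞) = 1 + 1 by norm_num, contDiff_succ_iff_deriv] at this
    exact this.2.2
  exact (h1.differentiable (by norm_num) t).hasDerivAt

theorem curvature_of_deriv_re {γ : ℝ → ℂ} {a : ℝ} (hre : (deriv γ a).re = 0) :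
    curvature γ a = |(deriv (deriv γ) a).re| / (deriv γ a).im ^ 2 := by
  rw [curvature, hre, ← Complex.abs_im_eq_norm.mpr hre, zero_mul, zero_sub, abs_neg, abs_mul,
    ← sq_abs (deriv γ a).im]
  rcases eq_or_ne |(deriv γ a).im| 0 with h | h
  · simp [h]
  · field_simp

/-- At a point with vertical tangent the curvature is the limit of twice the horizontal deviation
divided by the square of the vertical deviation; this quantity does not involve the
parametrisation. -/
theorem IsBilliard.tendsto_curvature {γ : ℝ → ℂ} (h : IsBilliard γ) {a : ℝ}
    (hre : (deriv γ a).re = 0) :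
    Tendsto (fun t => 2 * |(γ t).re - (γ a).re| / ((γ t).im - (γ a).im) ^ 2) (𝓝[≠] a)
      (𝓝 (curvature γ a)) := by
  have him : (deriv γ a).im ≠ 0 := fun e => h.deriv_ne_zero a (Complex.ext hre e)
  have h1 := tendsto_div_sq_of_deriv_eq_zero (fun t => hasDerivAt_re (h.hasDerivAt t)) hre
    (hasDerivAt_re (h.hasDerivAt_deriv a))
  have h2 := hasDerivAt_iff_tendsto_slope.mp (hasDerivAt_im (h.hasDerivAt a))
  have h3 := (h1.abs.const_mul 2).div (h2.pow 2) (pow_ne_zero 2 him)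
  have hval : 2 * |(deriv (deriv γ) a).re / 2| / (deriv γ a).im ^ 2 = curvature γ a := by
    rw [curvature_of_deriv_re hre, abs_div, abs_two]
    ring
  rw [hval] at h3
  refine h3.congr' ?_
  filter_upwards [self_mem_nhdsWithin] with t ht
  have ht' : t - a ≠ 0 := sub_ne_zero.mpr ht
  simp only [Pi.div_apply, slope_def_field, abs_div,
    abs_of_nonneg (sq_nonneg (t - a)), div_pow]
  field_simp

/-- Antipodal points on the horizontal axis have the same curvature. -/
theorem IsFrame.curvature_antipode {γ : ℝ → ℂ} {T₀ q T₁ q' : ℝ} (F : IsFrame γ T₀ q T₁ q') :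
    curvature γ T₁ = curvature γ T₀ := by
  have hre1 : (deriv γ T₁).re = 0 := by
    obtain ⟨c, hc⟩ := F.deriv_eq_smul (LinearIsometryEquiv.neg ℝ)
      (fun w hw => F.neg_mem w hw) (t := T₁) (t' := T₀) F.antipode
    rw [hc]
    simp [F.deriv_T₀_re]
  -- the symmetry of the curve expressed in the parameter, near `T₀`
  have hex : ∀ t, ∃ r ∈ Ico (T₁ - 1 / 2) (T₁ - 1 / 2 + 1), γ r = -γ t := fun t =>
    F.exists_mem_Ico (F.neg_mem _ ⟨t, rfl⟩) _
  choose φ hφ hγφ using hex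
  have hcont : Tendsto φ (𝓝 T₀) (𝓝 T₁) := by
    rw [Metric.tendsto_nhds]
    intro δ hδ
    set C := Icc (T₁ - 1 / 2) (T₁ - 1 / 2 + 1) \ Metric.ball T₁ δ with hC
    have hcomp : IsCompact (γ '' C) :=
      (isCompact_Icc.diff Metric.isOpen_ball).image F.continuous
    have hnot : -γ T₀ ∉ γ '' C := by
      rintro ⟨r, hr, e⟩
      rw [← F.antipode] at e
      have := F.eq_of_abs_sub_lt e (by linarith [hr.1.2]) (by linarith [hr.1.1])
      rw [this] at hr
      exact hr.2 (Metric.mem_ball_self hδ)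
    have := (F.continuous.neg.tendsto T₀).eventually (hcomp.isClosed.isOpen_compl.mem_nhds hnot)
    filter_upwards [this] with t ht
    by_contra hball
    exact ht ⟨φ t, ⟨Ico_subset_Icc_self (hφ t), hball⟩, hγφ t⟩
  have hne : Tendsto φ (𝓝[≠] T₀) (𝓝[≠] T₁) := by
    refine tendsto_nhdsWithin_iff.mpr ⟨hcont.mono_left nhdsWithin_le_nhds, ?_⟩
    have hnear : ∀ᶠ t in 𝓝[≠] T₀, t ∈ Ioo (T₀ - 1) (T₀ + 1) :=
      nhdsWithin_le_nhds (Ioo_mem_nhds (by linarith) (by linarith))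
    filter_upwards [self_mem_nhdsWithin, hnear] with t ht ht' e
    have h1 := hγφ t
    rw [show φ t = T₁ from e, F.antipode, neg_inj] at h1
    exact ht (F.eq_of_abs_sub_lt h1.symm (by linarith [ht'.2]) (by linarith [ht'.1]))
  refine tendsto_nhds_unique ((F.tendsto_curvature hre1).comp hne) ?_
  refine (F.tendsto_curvature F.deriv_T₀_re).congr fun t => ?_
  simp only [Function.comp, hγφ, F.antipode, Complex.neg_re, Complex.neg_im]
  rw [show -(γ t).re - -(γ T₀).re = -((γ t).re - (γ T₀).re) by ring, abs_neg]
  congr 1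
  ring

/-! ### The length function -/

/-- Half the length of the closed polygon with vertices `(-1)ⁱ yᵢ`, where `yᵢ = γ (u i)` for
`0 ≤ i ≤ m` and `y` is continued by `y₋ᵢ = conj yᵢ` to a sequence of period `2 m + 1`; the
segment between the consecutive vertices `± yᵢ` and `∓ yᵢ₊₁` has length `‖yᵢ + yᵢ₊₁‖`. -/
def halfLength (γ : ℝ → ℂ) (m : ℕ) (u : ℕ → ℝ) : ℝ :=
  ∑ i ∈ Finset.range m, ‖γ (u i) + γ (u (i + 1))‖ + (γ (u m)).re

/-- The derivative of `‖w₀ + w‖ + ‖w + w₁‖` when `w` moves with velocity `τ`. It vanishes for `τ`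
tangent to the curve at `w` precisely if the path through `-w₀`, `w`, `-w₁` obeys the reflection
law at `w`. -/
def imbalance (w₀ w w₁ τ : ℂ) : ℝ :=
  ⟪w + w₀, τ⟫_ℝ / ‖w + w₀‖ + ⟪w + w₁, τ⟫_ℝ / ‖w + w₁‖

theorem inner_eq_re_add_im (v w : ℂ) : ⟪v, w⟫_ℝ = v.re * w.re + v.im * w.im := by
  rw [Complex.inner]
  simp
  ring

theorem hasDerivAt_norm_of_ne_zero {f : ℝ → ℂ} {f' : ℂ} {t : ℝ} (hf : HasDerivAt f f' t)
    (h0 : f t ≠ 0) : HasDerivAt (fun r => ‖f r‖) (⟪f t, f'⟫_ℝ / ‖f t‖) t := by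
  have h1 := hf.norm_sq.sqrt (by simpa using h0)
  simp only [Real.sqrt_sq (norm_nonneg _)] at h1
  convert h1 using 1
  field_simp

theorem continuous_halfLength {γ : ℝ → ℂ} (hγ : Continuous γ) (m : ℕ) :
    Continuous (halfLength γ m) := by
  unfold halfLength
  fun_prop

theorem halfLength_update_sub {γ : ℝ → ℂ} {m j : ℕ} (hj : j + 2 ≤ m) (u : ℕ → ℝ) (t : ℝ) :
    halfLength γ m (Function.update u (j + 1) t) - halfLength γ m u =
      (‖γ t + γ (u j)‖ + ‖γ t + γ (u (j + 2))‖) -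
        (‖γ (u (j + 1)) + γ (u j)‖ + ‖γ (u (j + 1)) + γ (u (j + 2))‖) := by
  have hm : m ≠ j + 1 := by omega
  simp only [halfLength, Function.update_of_ne hm]
  rw [add_sub_add_right_eq_sub, ← Finset.sum_sub_distrib,
    Finset.sum_eq_add j (j + 1) (by omega)]
  · have h1 : j ≠ j + 1 := by omega
    have h2 : j + 1 + 1 ≠ j + 1 := by omega
    simp only [Function.update_self, Function.update_of_ne h1, Function.update_of_ne h2]
    rw [add_comm (γ (u j)) (γ t), add_comm (γ (u j)) (γ (u (j + 1)))]
    ring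
  · intro k _ hk
    have h1 : k ≠ j + 1 := hk.2
    have h2 : k + 1 ≠ j + 1 := by have := hk.1; omega
    simp only [Function.update_of_ne h1, Function.update_of_ne h2, sub_self]
  · intro h; simp at h; omega
  · intro h; simp at h; omega

theorem halfLength_update_last_sub {γ : ℝ → ℂ} (j : ℕ) (u : ℕ → ℝ) (t : ℝ) :
    halfLength γ (j + 1) (Function.update u (j + 1) t) - halfLength γ (j + 1) u =
      (‖γ t + γ (u j)‖ + (γ t).re) - (‖γ (u (j + 1)) + γ (u j)‖ + (γ (u (j + 1))).re) := by
  have hs : ∑ i ∈ Finset.range j, ‖γ (Function.update u (j + 1) t i) +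
      γ (Function.update u (j + 1) t (i + 1))‖ =
      ∑ i ∈ Finset.range j, ‖γ (u i) + γ (u (i + 1))‖ := by
    refine Finset.sum_congr rfl fun i hi => ?_
    rw [Finset.mem_range] at hi
    rw [Function.update_of_ne (by omega), Function.update_of_ne (by omega)]
  simp only [halfLength, Finset.sum_range_succ, hs, Function.update_self,
    Function.update_of_ne (show j ≠ j + 1 by omega)]
  rw [add_comm (γ (u j)) (γ t), add_comm (γ (u j)) (γ (u (j + 1)))]
  ring

/-! ### Instability of the constant sequence -/

theorem tendsto_im_div {γ : ℝ → ℂ} (h : IsBilliard γ) {a : ℝ} (h0 : (γ a).im = 0) (v : ℝ) :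
    Tendsto (fun ε : ℝ => (γ (a + ε * v)).im / ε) (𝓝[>] 0) (𝓝 (v * (deriv γ a).im)) := by
  have h1 : HasDerivAt (fun ε : ℝ => a + ε * v) v 0 := by
    simpa using ((hasDerivAt_id (0 : ℝ)).mul_const v).const_add a
  have h2 : HasDerivAt (fun ε : ℝ => (γ (a + ε * v)).im) ((deriv γ a).im * v) 0 :=
    HasDerivAt.comp (h₂ := fun r => (γ r).im) (0 : ℝ)
      (by simpa using hasDerivAt_im (h.hasDerivAt a)) h1
  have h3 := (hasDerivAt_iff_tendsto_slope.mp h2).mono_left (nhdsGT_le_nhdsNE 0)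
  rw [mul_comm]
  refine h3.congr fun ε => ?_
  simp [slope_def_field, h0]

theorem tendsto_re_div {γ : ℝ → ℂ} (h : IsBilliard γ) {a : ℝ} (h0 : (deriv γ a).re = 0) (v : ℝ) :
    Tendsto (fun ε : ℝ => ((γ (a + ε * v)).re - (γ a).re) / ε ^ 2) (𝓝[>] 0)
      (𝓝 (v ^ 2 * ((deriv (deriv γ) a).re / 2))) := by
  rcases eq_or_ne v 0 with rfl | hv
  · simp
  have h1 := tendsto_div_sq_of_deriv_eq_zero (fun t => hasDerivAt_re (h.hasDerivAt t)) h0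
    (hasDerivAt_re (h.hasDerivAt_deriv a))
  have h2 : Tendsto (fun ε : ℝ => a + ε * v) (𝓝[>] 0) (𝓝[≠] a) := by
    refine tendsto_nhdsWithin_iff.mpr ⟨?_, ?_⟩
    · have : Tendsto (fun ε : ℝ => a + ε * v) (𝓝 0) (𝓝 (a + 0 * v)) :=
        (by fun_prop : Continuous fun ε : ℝ => a + ε * v).tendsto 0
      rw [zero_mul, add_zero] at this
      exact this.mono_left nhdsWithin_le_nhds
    · filter_upwards [self_mem_nhdsWithin] with ε hε
      have : ε ≠ 0 := ne_of_gt hε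
      simpa using ⟨this, hv⟩
  refine ((h1.comp h2).const_mul (v ^ 2)).congr fun ε => ?_
  simp only [Function.comp, add_sub_cancel_left, mul_pow]
  rcases eq_or_ne ε 0 with rfl | hε
  · simp
  · field_simp

/-- Second-order expansion of the length of a segment near a perpendicular chord. -/
theorem IsFrame.tendsto_norm_div {γ : ℝ → ℂ} {T₀ q T₁ q' : ℝ} (F : IsFrame γ T₀ q T₁ q')
    (v w : ℝ) :
    Tendsto (fun ε : ℝ => (‖γ (T₀ + ε * v) + γ (T₀ + ε * w)‖ - 2 * (γ T₀).re) / ε ^ 2) (𝓝[>] 0)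
      (𝓝 ((v ^ 2 + w ^ 2) * ((deriv (deriv γ) T₀).re / 2) +
        (v + w) ^ 2 * ((deriv γ T₀).im ^ 2 / (4 * (γ T₀).re)))) := by
  have ha := F.re_pos_zero
  have hr := (tendsto_re_div F.toIsBilliard F.deriv_T₀_re v).add
    (tendsto_re_div F.toIsBilliard F.deriv_T₀_re w)
  have hi := (tendsto_im_div F.toIsBilliard F.im_zero v).add
    (tendsto_im_div F.toIsBilliard F.im_zero w)
  have hc : Tendsto (fun ε : ℝ => γ (T₀ + ε * v) + γ (T₀ + ε * w)) (𝓝[>] 0) (𝓝 (γ T₀ + γ T₀)) := by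
    have hcont := F.continuous
    have : Tendsto (fun ε : ℝ => γ (T₀ + ε * v) + γ (T₀ + ε * w)) (𝓝 0)
        (𝓝 (γ (T₀ + 0 * v) + γ (T₀ + 0 * w))) :=
      (by fun_prop : Continuous fun ε : ℝ => γ (T₀ + ε * v) + γ (T₀ + ε * w)).tendsto 0
    rw [zero_mul, zero_mul, add_zero] at this
    exact this.mono_left nhdsWithin_le_nhds
  have hd : Tendsto (fun ε : ℝ => ‖γ (T₀ + ε * v) + γ (T₀ + ε * w)‖ +
      (γ (T₀ + ε * v) + γ (T₀ + ε * w)).re) (𝓝[>] 0) (𝓝 (4 * (γ T₀).re)) := by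
    have := hc.norm.add ((Complex.continuous_re.tendsto _).comp hc)
    have hv : ‖γ T₀ + γ T₀‖ + (γ T₀ + γ T₀).re = 4 * (γ T₀).re := by
      rw [← two_mul, norm_mul, ← Complex.abs_re_eq_norm.mpr F.im_zero, abs_of_pos ha]
      simp
      ring
    rw [hv] at this
    exact this
  have hlim := hr.add ((hi.pow 2).div hd (by positivity))
  have hval : v ^ 2 * ((deriv (deriv γ) T₀).re / 2) + w ^ 2 * ((deriv (deriv γ) T₀).re / 2) +
      (v * (deriv γ T₀).im + w * (deriv γ T₀).im) ^ 2 / (4 * (γ T₀).re) =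
      (v ^ 2 + w ^ 2) * ((deriv (deriv γ) T₀).re / 2) +
        (v + w) ^ 2 * ((deriv γ T₀).im ^ 2 / (4 * (γ T₀).re)) := by ring
  rw [hval] at hlim
  refine hlim.congr' ?_
  filter_upwards [self_mem_nhdsWithin,
    hd.eventually (lt_mem_nhds (by positivity : 0 < 4 * (γ T₀).re))] with ε hε hpos
  have hε0 : ε ≠ 0 := ne_of_gt hε
  set W := γ (T₀ + ε * v) + γ (T₀ + ε * w) with hW
  have hsq : ‖W‖ ^ 2 = W.re ^ 2 + W.im ^ 2 := by
    rw [← Complex.normSq_eq_norm_sq, Complex.normSq_apply]; ring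
  have hre : W.re = (γ (T₀ + ε * v)).re + (γ (T₀ + ε * w)).re := by simp [hW]
  have him : W.im = (γ (T₀ + ε * v)).im + (γ (T₀ + ε * w)).im := by simp [hW]
  have hpos' := hpos.ne'
  simp only [Pi.div_apply]
  rw [← add_div, ← add_div, ← him, ← hW]
  field_simp
  linear_combination -hsq - (‖W‖ + W.re) * hre

/-- Summation by parts for a solution of `vₙ + vₙ₊₂ = 2 c vₙ₊₁`. The boundary term is zero
if `vₙ₊₁ = -vₙ`, as for an odd solution of period `2 n + 1`. -/
theorem sum_sq_add_eq {v : ℕ → ℝ} {c : ℝ} (h0 : v 0 = 0)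
    (hrec : ∀ n, v n + v (n + 2) = 2 * c * v (n + 1)) (n : ℕ) :
    ∑ i ∈ Finset.range n, (v i + v (i + 1)) ^ 2 =
      2 * (1 + c) * ∑ i ∈ Finset.range n, v (i + 1) ^ 2 - v n * (v n + v (n + 1)) := by
  induction n with
  | zero => simp [h0]
  | succ n ih =>
    rw [Finset.sum_range_succ, Finset.sum_range_succ, ih]
    linear_combination v (n + 1) * hrec n

theorem sum_half_sq {v : ℕ → ℝ} (h0 : v 0 = 0) (n : ℕ) :
    ∑ i ∈ Finset.range n, (v i ^ 2 + v (i + 1) ^ 2) + v n ^ 2 =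
      2 * ∑ i ∈ Finset.range n, v (i + 1) ^ 2 := by
  induction n with
  | zero => simp [h0]
  | succ n ih =>
    rw [Finset.sum_range_succ, Finset.sum_range_succ]
    linear_combination ih

/-- If the curvature is small enough, bending the constant sequence along `sin (2 π i / (2 m + 1))`
increases the length. -/
theorem IsFrame.exists_halfLength_lt {γ : ℝ → ℂ} {T₀ q T₁ q' : ℝ} (F : IsFrame γ T₀ q T₁ q')
    {m : ℕ} (hm : 1 ≤ m)
    (hκ : curvature γ T₀ * (2 * (γ T₀).re) < 2 * Real.cos (Real.pi / (2 * m + 1)) ^ 2) :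
    ∃ u : ℕ → ℝ, u 0 = T₀ ∧ (∀ i, u i ∈ Icc T₀ q) ∧
      halfLength γ m (fun _ => T₀) < halfLength γ m u := by
  have ha := F.re_pos_zero
  have hpi := Real.pi_pos
  set θ : ℝ := 2 * (Real.pi / (2 * m + 1)) with hθ
  set ρ := (deriv (deriv γ) T₀).re with hρ
  set c := (deriv γ T₀).im with hc
  have hc0 : 0 < c := F.deriv_T₀_im
  have hm' : (1 : ℝ) ≤ m := by exact_mod_cast hm
  have hθpos : 0 < θ := by positivity
  have hθm : (2 * m + 1) * θ = 2 * Real.pi := by rw [hθ]; field_simp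
  have hsin : ∀ i : ℕ, i ≤ m → |Real.sin (i * θ)| = Real.sin (i * θ) := by
    intro i hi
    have hi' : (i : ℝ) ≤ m := by exact_mod_cast hi
    refine abs_of_nonneg (Real.sin_nonneg_of_nonneg_of_le_pi (by positivity) ?_)
    nlinarith
  set v : ℕ → ℝ := fun i => Real.sin (i * θ) with hv
  have hv0 : v 0 = 0 := by simp [hv]
  have hrec : ∀ n, v n + v (n + 2) = 2 * Real.cos θ * v (n + 1) := by
    intro n
    simp only [hv]
    push_cast
    rw [show (n : ℝ) * θ = (n + 1) * θ - θ by ring,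
      show ((n : ℝ) + 2) * θ = (n + 1) * θ + θ by ring, Real.sin_sub, Real.sin_add]
    ring
  have hlast : v m + v (m + 1) = 0 := by
    simp only [hv]
    push_cast
    rw [show ((m : ℝ) + 1) * θ = 2 * Real.pi - m * θ by linarith, Real.sin_two_pi_sub]
    ring
  set V := ∑ i ∈ Finset.range m, v (i + 1) ^ 2 with hV
  have hVpos : 0 < V := by
    refine Finset.sum_pos' (fun _ _ => sq_nonneg _) ⟨0, Finset.mem_range.mpr hm, ?_⟩
    have : 0 < v (0 + 1) := by
      simp only [hv]
      refine Real.sin_pos_of_pos_of_lt_pi (by simpa using hθpos) ?_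
      push_cast
      nlinarith
    positivity
  -- the second variation; the absolute values keep the test sequence in the arc beyond the index
  -- `m`, where it does not enter the length
  have hlim : Tendsto (fun ε : ℝ => (halfLength γ m (fun i => T₀ + ε * |v i|) -
      halfLength γ m (fun _ => T₀)) / ε ^ 2) (𝓝[>] 0)
      (𝓝 (∑ i ∈ Finset.range m, ((v i ^ 2 + v (i + 1) ^ 2) * (ρ / 2) +
        (v i + v (i + 1)) ^ 2 * (c ^ 2 / (4 * (γ T₀).re))) + v m ^ 2 * (ρ / 2))) := by
    have h1 := (tendsto_finsetSum (Finset.range m) fun i _ =>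
      F.tendsto_norm_div (v i) (v (i + 1))).add
      (tendsto_re_div F.toIsBilliard F.deriv_T₀_re (v m))
    refine h1.congr fun ε => ?_
    have hsum : ∑ i ∈ Finset.range m, ‖γ (T₀ + ε * |v i|) + γ (T₀ + ε * |v (i + 1)|)‖ =
        ∑ i ∈ Finset.range m, ‖γ (T₀ + ε * v i) + γ (T₀ + ε * v (i + 1))‖ := by
      refine Finset.sum_congr rfl fun i hi => ?_
      rw [Finset.mem_range] at hi
      rw [hsin i hi.le, hsin (i + 1) hi]
    have hnorm : ‖γ T₀ + γ T₀‖ = 2 * (γ T₀).re := by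
      rw [← two_mul, norm_mul, ← Complex.abs_re_eq_norm.mpr F.im_zero, abs_of_pos ha]
      simp
    simp only [halfLength]
    rw [hsum, hsin m le_rfl, ← Finset.sum_div, ← add_div, Finset.sum_sub_distrib, hnorm]
    ring
  have hpos : 0 < ∑ i ∈ Finset.range m, ((v i ^ 2 + v (i + 1) ^ 2) * (ρ / 2) +
        (v i + v (i + 1)) ^ 2 * (c ^ 2 / (4 * (γ T₀).re))) + v m ^ 2 * (ρ / 2) := by
    have hcos : 2 * Real.cos (Real.pi / (2 * m + 1)) ^ 2 = 1 + Real.cos θ := by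
      rw [hθ, Real.cos_two_mul]; ring
    rw [hcos, curvature_of_deriv_re F.deriv_T₀_re, ← hρ, ← hc, div_mul_eq_mul_div,
      div_lt_iff₀ (by positivity)] at hκ
    rw [Finset.sum_add_distrib, ← Finset.sum_mul, ← Finset.sum_mul, sum_sq_add_eq hv0 hrec, hlast,
      mul_zero, sub_zero, ← hV]
    have h2 := sum_half_sq hv0 m
    rw [← hV] at h2
    have h3 : 0 < ρ + (1 + Real.cos θ) * c ^ 2 / (2 * (γ T₀).re) := by
      have : -ρ < (1 + Real.cos θ) * c ^ 2 / (2 * (γ T₀).re) := by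
        rw [lt_div_iff₀ (by positivity)]
        nlinarith [neg_abs_le ρ]
      linarith
    have h4 := mul_pos hVpos h3
    have h5 : V * (ρ + (1 + Real.cos θ) * c ^ 2 / (2 * (γ T₀).re)) =
        2 * V * (ρ / 2) + 2 * (1 + Real.cos θ) * V * (c ^ 2 / (4 * (γ T₀).re)) := by
      field_simp; ring
    rw [h5, ← h2] at h4
    linarith
  have hev : ∀ᶠ ε in 𝓝[>] (0 : ℝ), ε ≤ q - T₀ :=
    nhdsWithin_le_nhds (Iic_mem_nhds (by linarith [F.lt₁]))
  obtain ⟨ε, hε1, hε2, hε3⟩ :=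
    ((hlim.eventually (lt_mem_nhds hpos)).and (hev.and self_mem_nhdsWithin)).exists
  have hε0 : 0 < ε := hε3
  refine ⟨fun i => T₀ + ε * |v i|, by simp [hv0], fun i => ⟨?_, ?_⟩, ?_⟩
  · have := abs_nonneg (v i)
    nlinarith
  · have := Real.abs_sin_le_one (i * θ)
    have h1 : ε * |v i| ≤ ε * 1 := mul_le_mul_of_nonneg_left this hε0.le
    linarith
  · rw [lt_div_iff₀ (by positivity), zero_mul] at hε1
    linarith

/-! ### The critical sequence -/

/-- The maximum of the length over the sequences in the first quadrant that start on the axis is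
attained in the interior. -/
theorem IsFrame.exists_critical {γ : ℝ → ℂ} {T₀ q T₁ q' : ℝ} (F : IsFrame γ T₀ q T₁ q')
    {m : ℕ} (hm : 1 ≤ m)
    (hκ : curvature γ T₀ * (2 * (γ T₀).re) < 2 * Real.cos (Real.pi / (2 * m + 1)) ^ 2) :
    ∃ u : ℕ → ℝ, u 0 = T₀ ∧ (∀ i, 1 ≤ i → i ≤ m → u i ∈ Ioo T₀ q) ∧
      (∀ i, i + 2 ≤ m →
        imbalance (γ (u i)) (γ (u (i + 1))) (γ (u (i + 2))) (deriv γ (u (i + 1))) = 0) ∧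
      imbalance (γ (u (m - 1))) (γ (u m)) (conj (γ (u m))) (deriv γ (u m)) = 0 := by
  obtain ⟨u', hu'0, hu', hlt⟩ := F.exists_halfLength_lt hm hκ
  set C : Set (ℕ → ℝ) := Set.pi univ fun i => if i = 0 then {T₀} else Icc T₀ q with hC
  have hCc : IsCompact C := by
    refine isCompact_univ_pi fun i => ?_
    split_ifs
    · exact isCompact_singleton
    · exact isCompact_Icc
  have hCmem : ∀ w : ℕ → ℝ, w ∈ C ↔ w 0 = T₀ ∧ ∀ i, w i ∈ Icc T₀ q := by
    intro w
    simp only [hC, Set.mem_pi, mem_univ, true_implies]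
    constructor
    · intro h
      have h0 : w 0 = T₀ := by simpa using h 0
      refine ⟨h0, fun i => ?_⟩
      rcases eq_or_ne i 0 with rfl | hi
      · rw [h0]; exact ⟨le_rfl, F.lt₁.le⟩
      · simpa [hi] using h i
    · rintro ⟨h0, h⟩ i
      split_ifs with hi
      · rw [hi, h0]; rfl
      · exact h i
  have hu'C : u' ∈ C := (hCmem _).mpr ⟨hu'0, hu'⟩
  obtain ⟨u, huC, hmax⟩ := hCc.exists_isMaxOn ⟨u', hu'C⟩
    (continuous_halfLength F.continuous m).continuousOn
  obtain ⟨hu0, hu⟩ := (hCmem u).mp huC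
  have hupd : ∀ j, ∀ t ∈ Icc T₀ q,
      halfLength γ m (Function.update u (j + 1) t) - halfLength γ m u ≤ 0 := by
    intro j t ht
    refine sub_nonpos.mpr (hmax ((hCmem _).mpr ⟨?_, fun i => ?_⟩))
    · rw [Function.update_of_ne (by omega), hu0]
    · rcases eq_or_ne i (j + 1) with rfl | hi
      · rwa [Function.update_self]
      · rw [Function.update_of_ne hi]; exact hu i
  have hcond : ∀ {f : ℝ → ℝ} {f' : ℝ} {t₀ : ℝ}, (∀ t ∈ Icc T₀ q, f t - f t₀ ≤ 0) →
      HasDerivAt f f' t₀ → (t₀ = T₀ → f' ≤ 0) ∧ (t₀ = q → 0 ≤ f') ∧ (t₀ ∈ Ioo T₀ q → f' = 0) := by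
    intro f f' t₀ hf hd
    refine ⟨?_, ?_, fun h => ?_⟩
    · rintro rfl
      exact deriv_nonpos_of_max_left hd F.lt₁ fun t ht => by linarith [hf t ht]
    · rintro rfl
      exact deriv_nonneg_of_max_right hd F.lt₁ fun t ht => by linarith [hf t ht]
    · refine IsLocalMax.hasDerivAt_eq_zero ?_ hd
      filter_upwards [Icc_mem_nhds h.1 h.2] with t ht
      linarith [hf t ht]
  have hne : ∀ {t t' : ℝ}, t ∈ Icc T₀ q → t' ∈ Icc T₀ q → t ≠ q → γ t + γ t' ≠ 0 := by
    intro t t' ht ht' hq e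
    have h1 := F.re_nonneg ht
    have h2 := F.re_nonneg ht'
    have h3 := congrArg Complex.re e
    rw [Complex.add_re, Complex.zero_re] at h3
    exact hq (F.eq_q_of_re ht (by linarith))
  have hne' : ∀ {t t' : ℝ}, t ∈ Icc T₀ q → t' ∈ Icc T₀ q → γ t + γ t' ≠ 0 := by
    intro t t' ht ht' e
    by_cases hq : t = q
    · have h1 := F.im_nonneg ht'
      have h2 := F.im_q
      have h3 := congrArg Complex.im e
      rw [Complex.add_im, Complex.zero_im, hq] at h3
      linarith
    · exact hne ht ht' hq e
  have hdn : ∀ {t t' : ℝ}, t ∈ Icc T₀ q → t' ∈ Icc T₀ q → HasDerivAt (fun r => ‖γ r + γ t'‖)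
      (⟪γ t + γ t', deriv γ t⟫_ℝ / ‖γ t + γ t'‖) t := fun ht ht' =>
    hasDerivAt_norm_of_ne_zero ((F.hasDerivAt _).add_const _) (hne' ht ht')
  -- first-order conditions at the maximum
  have hinner : ∀ j, j + 2 ≤ m → ∀ f', f' = imbalance (γ (u j)) (γ (u (j + 1))) (γ (u (j + 2)))
      (deriv γ (u (j + 1))) → (u (j + 1) = T₀ → f' ≤ 0) ∧ (u (j + 1) = q → 0 ≤ f') ∧
        (u (j + 1) ∈ Ioo T₀ q → f' = 0) := by
    rintro j hj f' rfl
    refine hcond (f := fun r => ‖γ r + γ (u j)‖ + ‖γ r + γ (u (j + 2))‖)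
      (fun t ht => ?_) ((hdn (hu _) (hu _)).add (hdn (hu _) (hu _)))
    have := hupd j t ht
    rwa [halfLength_update_sub hj] at this
  have hlast : ∀ j, j + 1 = m → ∀ f', f' = ⟪γ (u (j + 1)) + γ (u j), deriv γ (u (j + 1))⟫_ℝ /
      ‖γ (u (j + 1)) + γ (u j)‖ + (deriv γ (u (j + 1))).re → (u (j + 1) = T₀ → f' ≤ 0) ∧
        (u (j + 1) = q → 0 ≤ f') ∧ (u (j + 1) ∈ Ioo T₀ q → f' = 0) := by
    rintro j rfl f' rfl
    refine hcond (f := fun r => ‖γ r + γ (u j)‖ + (γ r).re)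
      (fun t ht => ?_) ((hdn (hu _) (hu _)).add (hasDerivAt_re (F.hasDerivAt _)))
    have := hupd j t ht
    rwa [halfLength_update_last_sub] at this
  have hnorm_pos : ∀ {t t' : ℝ}, t ∈ Icc T₀ q → t' ∈ Icc T₀ q → 0 < ‖γ t + γ t'‖ :=
    fun ht ht' => norm_pos_iff.mpr (hne' ht ht')
  -- the derivative of a segment length at the two ends of the arc has a sign
  have hsignT : ∀ {t' : ℝ}, t' ∈ Icc T₀ q → 0 ≤ ⟪γ T₀ + γ t', deriv γ T₀⟫_ℝ / ‖γ T₀ + γ t'‖ ∧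
      (⟪γ T₀ + γ t', deriv γ T₀⟫_ℝ / ‖γ T₀ + γ t'‖ ≤ 0 → t' = T₀) := by
    intro t' ht'
    have hp := hnorm_pos ⟨le_rfl, F.lt₁.le⟩ ht'
    have hi : ⟪γ T₀ + γ t', deriv γ T₀⟫_ℝ = (γ t').im * (deriv γ T₀).im := by
      rw [inner_eq_re_add_im, F.deriv_T₀_re, Complex.add_im, F.im_zero]; ring
    rw [hi]
    refine ⟨div_nonneg (mul_nonneg (F.im_nonneg ht') F.deriv_T₀_im.le) hp.le, fun h => ?_⟩
    rw [div_le_iff₀ hp, zero_mul] at h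
    exact F.eq_T₀_of_im ht' (nonpos_of_mul_nonpos_left h F.deriv_T₀_im)
  have hsignq : ∀ {t' : ℝ}, t' ∈ Icc T₀ q → ⟪γ q + γ t', deriv γ q⟫_ℝ / ‖γ q + γ t'‖ ≤ 0 ∧
      (0 ≤ ⟪γ q + γ t', deriv γ q⟫_ℝ / ‖γ q + γ t'‖ → t' = q) := by
    intro t' ht'
    have hp := hnorm_pos ⟨F.lt₁.le, le_rfl⟩ ht'
    have hi : ⟪γ q + γ t', deriv γ q⟫_ℝ = (γ t').re * (deriv γ q).re := by
      rw [inner_eq_re_add_im, F.deriv_q_im, Complex.add_re, F.re_q]; ring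
    have h0 := F.re_nonneg ht'
    have hd := F.deriv_q_re
    rw [hi]
    refine ⟨div_nonpos_of_nonpos_of_nonneg (by nlinarith) hp.le, fun h => ?_⟩
    rw [le_div_iff₀ hp, zero_mul] at h
    exact F.eq_q_of_re ht' (by nlinarith)
  have hneq : ∀ i, i ≤ m → u i ≠ q := by
    intro i
    induction i with
    | zero => intro _; rw [hu0]; exact F.lt₁.ne
    | succ j ih =>
      intro hj e
      refine ih (by omega) ?_
      have h1 := hsignq (hu j)
      rcases Nat.lt_or_ge (j + 1) m with hlt' | hge
      · have h2 := (hinner j hlt' _ rfl).2.1 e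
        have h3 := hsignq (hu (j + 2))
        rw [imbalance, e] at h2
        exact h1.2 (by linarith [h3.1])
      · have h2 := (hlast j (by omega) _ rfl).2.1 e
        rw [e] at h2
        linarith [h1.1, F.deriv_q_re]
  -- one vertex at the end of the axis forces its neighbours to be there, too
  have hspread : ∀ j, j + 1 ≤ m → u (j + 1) = T₀ → u j = T₀ ∧ (j + 2 ≤ m → u (j + 2) = T₀) := by
    intro j hj e
    have h1 := hsignT (hu j)
    rcases Nat.lt_or_ge (j + 1) m with hlt' | hge
    · have h2 := (hinner j hlt' _ rfl).1 e
      have h3 := hsignT (hu (j + 2))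
      rw [imbalance, e] at h2
      exact ⟨h1.2 (by linarith [h3.1]), fun _ => h3.2 (by linarith [h1.1])⟩
    · have h2 := (hlast j (by omega) _ rfl).1 e
      rw [e, F.deriv_T₀_re] at h2
      exact ⟨h1.2 (by linarith), fun h => absurd h (by omega)⟩
  have hneT : ∀ i, 1 ≤ i → i ≤ m → u i ≠ T₀ := by
    intro i hi him e
    have hdown : ∀ k, k ≤ i → u (i - k) = T₀ := by
      intro k
      induction k with
      | zero => intro _; exact e
      | succ k ih =>
        intro hk
        have h1 : i - k = i - (k + 1) + 1 := by omega
        have h2 := ih (by omega)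
        rw [h1] at h2
        exact (hspread _ (by omega) h2).1
    have hone : u 1 = T₀ := by
      have := hdown (i - 1) (by omega)
      rwa [show i - (i - 1) = 1 by omega] at this
    have hall : ∀ k, k + 1 ≤ m → u (k + 1) = T₀ := by
      intro k
      induction k with
      | zero => intro _; exact hone
      | succ k ih => intro hk; exact (hspread k (by omega) (ih (by omega))).2 hk
    have hall' : ∀ k, k ≤ m → u k = T₀ := by
      intro k hk
      rcases k with _ | k
      · exact hu0
      · exact hall k hk
    have heq : halfLength γ m u = halfLength γ m fun _ => T₀ := by
      simp only [halfLength]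
      rw [hall' m le_rfl]
      congr 1
      refine Finset.sum_congr rfl fun k hk => ?_
      rw [Finset.mem_range] at hk
      rw [hall' k hk.le, hall' (k + 1) hk]
    have := hmax hu'C
    simp only [mem_ofPred_eq] at this
    linarith
  have hint : ∀ i, 1 ≤ i → i ≤ m → u i ∈ Ioo T₀ q := fun i h1 h2 =>
    ⟨lt_of_le_of_ne (hu i).1 (hneT i h1 h2).symm, lt_of_le_of_ne (hu i).2 (hneq i h2)⟩
  refine ⟨u, hu0, hint, fun i hi => (hinner i hi _ rfl).2.2 (hint _ (by omega) (by omega)), ?_⟩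
  obtain ⟨j, rfl⟩ : ∃ j, m = j + 1 := ⟨m - 1, by omega⟩
  have h1 := (hlast j rfl _ rfl).2.2 (hint _ hm le_rfl)
  rw [Nat.add_sub_cancel, imbalance, ← h1, Complex.add_conj]
  have hre : 0 < (γ (u (j + 1))).re :=
    F.re_pos _ ⟨by linarith [(hint _ hm le_rfl).1, F.lt₄], (hint _ hm le_rfl).2⟩
  congr 1
  rw [inner_eq_re_add_im, Complex.norm_real, Real.norm_of_nonneg (by positivity)]
  simp only [Complex.ofReal_re, Complex.ofReal_im, zero_mul, add_zero]
  field_simp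

/-! ### Symmetric periodic continuation -/

/-- The continuation of `Y 0, …, Y m` to a sequence `y : ℤ → ℂ` of period `2 m + 1` with
`y₋ⱼ = conj yⱼ`. -/
def symmExtend (m : ℕ) (Y : ℕ → ℂ) (j : ℤ) : ℂ :=
  if j % (2 * m + 1) ≤ m then Y (j % (2 * m + 1)).toNat
  else conj (Y (2 * m + 1 - j % (2 * m + 1)).toNat)

theorem symmExtend_add (m : ℕ) (Y : ℕ → ℂ) (j n : ℤ) :
    symmExtend m Y ((2 * m + 1) * n + j) = symmExtend m Y j := by
  simp [symmExtend]

theorem symmExtend_natCast {m : ℕ} (Y : ℕ → ℂ) {i : ℕ} (hi : i ≤ m) :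
    symmExtend m Y i = Y i := by
  have : (i : ℤ) % (2 * m + 1) = i := Int.emod_eq_of_lt (by omega) (by omega)
  simp [symmExtend, this, hi]

theorem symmExtend_neg_natCast {m : ℕ} {Y : ℕ → ℂ} (h0 : conj (Y 0) = Y 0) {i : ℕ} (hi : i ≤ m) :
    symmExtend m Y (-i) = conj (Y i) := by
  rcases Nat.eq_zero_or_pos i with rfl | hpos
  · rw [h0]
    simpa using symmExtend_natCast Y (Nat.zero_le m)
  · have : (-(i : ℤ)) % (2 * m + 1) = 2 * m + 1 - i := by
      rw [← Int.add_emod_right, Int.emod_eq_of_lt (by omega) (by omega)]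
      ring
    have h1 : ¬ ((2 * m + 1 - i : ℤ) ≤ m) := by omega
    simp [symmExtend, this, h1]

theorem exists_eq_mul_add_or_sub (m : ℕ) (j : ℤ) :
    ∃ n : ℤ, ∃ i : ℕ, i ≤ m ∧ (j = (2 * m + 1) * n + i ∨ j = (2 * m + 1) * n + -i) := by
  have h1 := Int.mul_ediv_add_emod j (2 * m + 1)
  have h2 := Int.emod_nonneg j (show (2 * m + 1 : ℤ) ≠ 0 by omega)
  have h3 := Int.emod_lt_of_pos j (show (0 : ℤ) < 2 * m + 1 by omega)
  rcases le_or_gt (j % (2 * m + 1)) m with h | h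
  · exact ⟨j / (2 * m + 1), (j % (2 * m + 1)).toNat, by omega, Or.inl (by omega)⟩
  · refine ⟨j / (2 * m + 1) + 1, (2 * m + 1 - j % (2 * m + 1)).toNat, by omega, Or.inr ?_⟩
    rw [Int.toNat_of_nonneg (by omega), mul_add]
    omega

theorem symmExtend_neg {m : ℕ} {Y : ℕ → ℂ} (h0 : conj (Y 0) = Y 0) (j : ℤ) :
    symmExtend m Y (-j) = conj (symmExtend m Y j) := by
  obtain ⟨n, i, hi, rfl | rfl⟩ := exists_eq_mul_add_or_sub m j
  · rw [neg_add, ← mul_neg, symmExtend_add, symmExtend_add, symmExtend_neg_natCast h0 hi,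
      symmExtend_natCast Y hi]
  · rw [neg_add, ← mul_neg, neg_neg, symmExtend_add, symmExtend_add, symmExtend_neg_natCast h0 hi,
      symmExtend_natCast Y hi, Complex.conj_conj]

/-! ### The reflection law -/

theorem imbalance_comm (w₀ w w₁ τ : ℂ) : imbalance w₁ w w₀ τ = imbalance w₀ w w₁ τ :=
  add_comm _ _

theorem imbalance_map (g : ℂ ≃ₗᵢ[ℝ] ℂ) (w₀ w w₁ τ : ℂ) :
    imbalance (g w₀) (g w) (g w₁) (g τ) = imbalance w₀ w w₁ τ := by
  simp only [imbalance, ← map_add, g.inner_map_map, g.norm_map]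

theorem imbalance_smul (w₀ w w₁ τ : ℂ) (c : ℝ) :
    imbalance w₀ w w₁ (c • τ) = c * imbalance w₀ w w₁ τ := by
  simp only [imbalance, inner_smul_right]
  ring

/-- The first-order condition is carried along by the symmetries of the curve. -/
theorem IsBisymmetric.imbalance_eq_zero {γ : ℝ → ℂ} (h : IsBisymmetric γ) (g : ℂ ≃ₗᵢ[ℝ] ℂ)
    (hg : ∀ w ∈ range γ, g.symm w ∈ range γ) {t t' : ℝ} (e : γ t = g (γ t')) {w₀ w w₁ : ℂ}
    (h0 : imbalance w₀ w w₁ (deriv γ t') = 0) :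
    imbalance (g w₀) (g w) (g w₁) (deriv γ t) = 0 := by
  obtain ⟨c, hc⟩ := h.deriv_eq_smul g hg e
  rw [hc, imbalance_smul, imbalance_map, h0, mul_zero]

/-- The bent `(2 m + 1)`-periodic sequence `y` in the right half plane: it satisfies the
first-order condition everywhere, and its first `m` terms after `y₀` lie above the axis. -/
theorem IsFrame.exists_sequence {γ : ℝ → ℂ} {T₀ q T₁ q' : ℝ} (F : IsFrame γ T₀ q T₁ q')
    {m : ℕ} (hm : 1 ≤ m)
    (hκ : curvature γ T₀ * (2 * (γ T₀).re) < 2 * Real.cos (Real.pi / (2 * m + 1)) ^ 2) :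
    ∃ y : ℤ → ℂ, (∀ n j, y ((2 * m + 1) * n + j) = y j) ∧ (∀ j, y (-j) = conj (y j)) ∧
      (∀ j, y j ∈ range γ) ∧ (∀ j, 0 < (y j).re) ∧ y 0 = γ T₀ ∧
      (∀ i : ℕ, 1 ≤ i → i ≤ m → 0 < (y i).im) ∧
      ∀ j t, γ t = y j → imbalance (y (j - 1)) (y j) (y (j + 1)) (deriv γ t) = 0 := by
  obtain ⟨u, hu0, hu, hcrit, hlast⟩ := F.exists_critical hm hκ
  set Y : ℕ → ℂ := fun i => γ (u i) with hY
  have hY0 : conj (Y 0) = Y 0 := by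
    rw [Complex.conj_eq_iff_im]
    simp [hY, hu0, F.im_zero]
  set y := symmExtend m Y with hy
  have hper : ∀ n j, y ((2 * m + 1) * n + j) = y j := fun n j => symmExtend_add m Y j n
  have hneg : ∀ j, y (-j) = conj (y j) := symmExtend_neg hY0
  have hyi : ∀ i : ℕ, i ≤ m → y i = γ (u i) := fun i hi => symmExtend_natCast Y hi
  have hre : ∀ i, i ≤ m → 0 < (γ (u i)).re := by
    intro i hi
    rcases Nat.eq_zero_or_pos i with rfl | hpos
    · rw [hu0]; exact F.re_pos_zero
    · have := hu i hpos hi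
      exact F.re_pos _ ⟨by linarith [this.1, F.lt₄], this.2⟩
  -- the first-order condition at the first half of the vertices
  have hbase : ∀ i : ℕ, i ≤ m →
      imbalance (y (i - 1)) (y i) (y (i + 1)) (deriv γ (u i)) = 0 := by
    intro i hi
    rcases Nat.eq_zero_or_pos i with rfl | hpos
    · have h1 : y (((0 : ℕ) : ℤ) - 1) = conj (y 1) := by
        rw [← hneg]; simp
      have h2 : y 0 = γ T₀ := by rw [← hu0]; exact_mod_cast hyi 0 (Nat.zero_le m)
      rw [h1, hu0]
      simp only [Nat.cast_zero, zero_add, h2, imbalance, inner_eq_re_add_im, F.deriv_T₀_re,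
        mul_zero, Complex.add_im, F.im_zero, Complex.conj_im]
      rw [show γ T₀ + conj (y 1) = conj (γ T₀ + y 1) by
        rw [map_add, Complex.conj_eq_iff_im.mpr F.im_zero], Complex.norm_conj]
      ring
    · obtain ⟨j, rfl⟩ : ∃ j, i = j + 1 := ⟨i - 1, by omega⟩
      have h1 : y (((j + 1 : ℕ) : ℤ) - 1) = γ (u j) := by
        rw [← hyi j (by omega)]; congr 1; push_cast; ring
      rw [h1, hyi _ hi]
      rcases Nat.lt_or_ge (j + 1) m with hlt | hge
      · have h2 : y (((j + 1 : ℕ) : ℤ) + 1) = γ (u (j + 2)) := by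
          rw [← hyi (j + 2) (by omega)]; congr 1
        rw [h2]
        exact hcrit j hlt
      · have hjm : m = j + 1 := by omega
        have h2 : y (((j + 1 : ℕ) : ℤ) + 1) = conj (γ (u (j + 1))) := by
          rw [← hyi (j + 1) hi, ← hneg, ← hper 1 (-((j + 1 : ℕ) : ℤ))]
          congr 1
          rw [hjm]
          push_cast
          ring
        rw [h2]
        rw [hjm, Nat.add_sub_cancel] at hlast
        exact hlast
  refine ⟨y, hper, hneg, fun j => ?_, fun j => ?_, ?_, fun i h1 h2 => ?_, fun j t ht => ?_⟩
  · obtain ⟨n, i, hi, rfl | rfl⟩ := exists_eq_mul_add_or_sub m j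
    · rw [hper, hyi i hi]; exact ⟨_, rfl⟩
    · rw [hper, hneg, hyi i hi]; exact F.conj_mem _ ⟨_, rfl⟩
  · obtain ⟨n, i, hi, rfl | rfl⟩ := exists_eq_mul_add_or_sub m j
    · rw [hper, hyi i hi]; exact hre i hi
    · rw [hper, hneg, hyi i hi, Complex.conj_re]; exact hre i hi
  · rw [← hu0]; exact_mod_cast hyi 0 (Nat.zero_le m)
  · rw [hyi i h2]
    have := hu i h1 h2
    exact F.im_pos _ ⟨this.1, by linarith [this.2, F.lt₂]⟩
  · obtain ⟨n, i, hi, rfl | rfl⟩ := exists_eq_mul_add_or_sub m j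
    · rw [hper, hyi i hi] at ht
      have := F.imbalance_eq_zero (LinearIsometryEquiv.refl ℝ ℂ) (fun w hw => hw) ht (hbase i hi)
      rw [add_sub_assoc, add_assoc, hper, hper, hper]
      exact this
    -- conjugation reverses the order of the neighbours
    · rw [hper, hneg, hyi i hi] at ht
      have := F.imbalance_eq_zero Complex.conjLIE (fun w hw => F.conj_mem w hw) ht (hbase i hi)
      rw [add_sub_assoc, add_assoc, hper, hper, hper, imbalance_comm, hneg,
        show -(i : ℤ) + 1 = -(i - 1) by ring, show -(i : ℤ) - 1 = -(i + 1) by ring, hneg, hneg]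
      exact this

/-- The sequence that alternates between `y` and its mirror image in the origin. -/
def alternate (y : ℤ → ℂ) (j : ℤ) : ℂ := if Even j then y j else -y j

theorem alternate_of_even (y : ℤ → ℂ) {j : ℤ} (hj : Even j) : alternate y j = y j := if_pos hj

theorem alternate_of_odd (y : ℤ → ℂ) {j : ℤ} (hj : ¬ Even j) : alternate y j = -y j := if_neg hj

theorem angle_eq_angle_of_imbalance {w₀ w w₁ τ : ℂ} (h : imbalance w₀ w w₁ τ = 0) :
    InnerProductGeometry.angle (w + w₀) τ = InnerProductGeometry.angle τ (-(w + w₁)) := by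
  rw [InnerProductGeometry.angle, InnerProductGeometry.angle, inner_neg_right, norm_neg,
    real_inner_comm _ τ]
  congr 1
  rw [imbalance] at h
  rw [← div_div, mul_comm ‖τ‖, ← div_div, eq_neg_of_add_eq_zero_left h, neg_div,
    neg_div, neg_div]

theorem IsBisymmetric.isBilliardOrbit_alternate {γ : ℝ → ℂ} (h : IsBisymmetric γ) {y : ℤ → ℂ}
    (hmem : ∀ j, y j ∈ range γ) (hre : ∀ j, 0 < (y j).re)
    (hbal : ∀ j t, γ t = y j → imbalance (y (j - 1)) (y j) (y (j + 1)) (deriv γ t) = 0) :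
    IsBilliardOrbit γ (alternate y) := by
  refine ⟨⟨fun j => ?_, fun j e => ?_⟩, fun j t ht => ?_⟩
  · by_cases hj : Even j
    · rw [alternate_of_even y hj]; exact hmem j
    · rw [alternate_of_odd y hj]; exact h.neg_mem _ (hmem j)
  · have h1 := hre j
    have h2 := hre (j + 1)
    by_cases hj : Even j
    · rw [alternate_of_even y hj, alternate_of_odd y (by simpa [Int.even_add_one] using hj)] at e
      rw [← e, Complex.neg_re] at h1
      linarith
    · rw [alternate_of_odd y hj, alternate_of_even y (by simpa [Int.even_add_one] using hj)] at e
      rw [e, Complex.neg_re] at h2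
      linarith
  · by_cases hj : Even j
    · have h1 : ¬ Even (j - 1) := by simpa [Int.even_sub_one] using hj
      have h2 : ¬ Even (j + 1) := by simpa [Int.even_add_one] using hj
      rw [alternate_of_even y hj] at ht ⊢
      rw [alternate_of_odd y h1, alternate_of_odd y h2]
      have := angle_eq_angle_of_imbalance (hbal j t ht)
      rw [sub_neg_eq_add, this]
      congr 1
      ring
    · have h1 : Even (j - 1) := by simpa [Int.even_sub_one] using hj
      have h2 : Even (j + 1) := by simpa [Int.even_add_one] using hj
      rw [alternate_of_odd y hj] at ht ⊢
      rw [alternate_of_even y h1, alternate_of_even y h2]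
      obtain ⟨t', ht'⟩ := hmem j
      rw [← ht'] at ht
      have := angle_eq_angle_of_imbalance (h.imbalance_eq_zero (LinearIsometryEquiv.neg ℝ)
        (fun w hw => h.neg_mem w hw) ht (hbal j t' ht'))
      simp only [LinearIsometryEquiv.coe_neg] at this
      rw [show -y j - y (j - 1) = -y j + -y (j - 1) by ring, this]
      congr 1
      ring

/-! ### Counting sign changes -/

/-- A sequence of period `2 m + 1` that vanishes at the multiples of `2 m + 1`, is positive in the
first and negative in the second half of each period, changes sign four times along two periods. -/
theorem isGreatest_signChanges {m : ℕ} (hm : 1 ≤ m) {d : ℤ → ℝ}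
    (hz : ∀ n : ℤ, d ((2 * m + 1) * n) = 0)
    (hpos : ∀ (n : ℤ) (i : ℕ), 1 ≤ i → i ≤ m → 0 < d ((2 * m + 1) * n + i))
    (hneg : ∀ (n : ℤ) (i : ℕ), 1 ≤ i → i ≤ m → d ((2 * m + 1) * n + -i) < 0) :
    IsGreatest {k : ℕ | ∃ i : ℕ → ℤ, (∀ j < k, i j < i (j + 1)) ∧
      i k = i 0 + 2 * (2 * m + 1) ∧ ∀ j < k, d (i j) * d (i (j + 1)) < 0} 4 := by
  constructor
  -- the terms next to the zeros of `d` have alternating signs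
  · refine ⟨fun j => if j = 0 then 1 else if j = 1 then 2 * m else if j = 2 then 2 * m + 2 else
      if j = 3 then 4 * m + 1 else 4 * m + 3, ?_, ?_, ?_⟩
    · intro j hj
      interval_cases j <;> simp <;> omega
    · simp; ring
    · have h1 : 0 < d 1 := by simpa using hpos 0 1 le_rfl hm
      have h2 : d (2 * m) < 0 := by
        have := hneg 1 1 le_rfl hm
        rwa [show ((2 * m + 1) * 1 + -((1 : ℕ) : ℤ) : ℤ) = 2 * m by push_cast; ring] at this
      have h3 : 0 < d (2 * m + 2) := by
        have := hpos 1 1 le_rfl hm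
        rwa [show ((2 * m + 1) * 1 + ((1 : ℕ) : ℤ) : ℤ) = 2 * m + 2 by push_cast; ring] at this
      have h4 : d (4 * m + 1) < 0 := by
        have := hneg 2 1 le_rfl hm
        rwa [show ((2 * m + 1) * 2 + -((1 : ℕ) : ℤ) : ℤ) = 4 * m + 1 by push_cast; ring] at this
      have h5 : 0 < d (4 * m + 3) := by
        have := hpos 2 1 le_rfl hm
        rwa [show ((2 * m + 1) * 2 + ((1 : ℕ) : ℤ) : ℤ) = 4 * m + 3 by push_cast; ring] at this
      intro j hj
      interval_cases j <;> simp <;>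
        first | exact mul_neg_of_pos_of_neg ‹_› ‹_› | exact mul_neg_of_neg_of_pos ‹_› ‹_›
  · rintro k ⟨i, hmono, hk, hd⟩
    have hs : (2 * m + 1 : ℤ) ≠ 0 := by omega
    -- the number of the half period containing `j` determines the sign of `d j`
    have hsign : ∀ j, d j ≠ 0 → (0 < d j ↔ Even (2 * j / (2 * m + 1))) := by
      intro j hj
      obtain ⟨n, l, hl, h⟩ := exists_eq_mul_add_or_sub m j
      have hl0 : 1 ≤ l := by
        by_contra! hcon
        obtain rfl : l = 0 := by omega
        refine hj ?_
        rcases h with h | h <;> · rw [h]; simpa using hz n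
      rcases h with rfl | rfl
      · rw [show 2 * ((2 * m + 1) * n + (l : ℤ)) = 2 * l + (2 * m + 1) * (2 * n) by ring,
          Int.add_mul_ediv_left _ _ hs, Int.ediv_eq_zero_of_lt (by omega) (by omega), zero_add]
        exact iff_of_true (hpos n l hl0 hl) (even_two_mul n)
      · rw [show 2 * ((2 * m + 1) * n + -(l : ℤ)) =
            (2 * m + 1 - 2 * l) + (2 * m + 1) * (2 * n - 1) by ring,
          Int.add_mul_ediv_left _ _ hs, Int.ediv_eq_zero_of_lt (by omega) (by omega), zero_add]
        refine iff_of_false (hneg n l hl0 hl).not_gt ?_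
        rw [Int.not_even_iff_odd]
        exact ⟨n - 1, by ring⟩
    have hstep : ∀ j < k, 2 * i j / (2 * m + 1) + 1 ≤ 2 * i (j + 1) / (2 * m + 1) := by
      intro j hj
      have h1 : 2 * i j / (2 * m + 1) ≤ 2 * i (j + 1) / (2 * m + 1) :=
        Int.ediv_le_ediv (by omega) (by linarith [hmono j hj])
      have hne : 2 * i j / (2 * m + 1) ≠ 2 * i (j + 1) / (2 * m + 1) := by
        intro e
        have hdj := hd j hj
        have ha := hsign (i j) (left_ne_zero_of_mul hdj.ne)
        have hb := hsign (i (j + 1)) (right_ne_zero_of_mul hdj.ne)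
        rw [e, ← hb] at ha
        rcases mul_neg_iff.mp hdj with h | h
        · exact h.2.not_gt (ha.mp h.1)
        · exact h.1.not_gt (ha.mpr h.2)
      omega
    have hind : ∀ j : ℕ, j ≤ k → 2 * i 0 / (2 * m + 1) + j ≤ 2 * i j / (2 * m + 1) := by
      intro j
      induction j with
      | zero => intro _; simp
      | succ j ih =>
        intro hj
        have h1 := ih (by omega)
        have h2 := hstep j (by omega)
        push_cast
        omega
    have h := hind k le_rfl
    rw [hk, show 2 * (i 0 + 2 * (2 * m + 1)) = 2 * i 0 + (2 * m + 1) * 4 by ring,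
      Int.add_mul_ediv_left _ _ hs] at h
    omega

/-! ### Rotation numbers -/

theorem tendsto_div_of_bounded {x : ℤ → ℝ} {ω M : ℝ} (h : ∀ j, |x j - ω * j| ≤ M) {l : Filter ℤ}
    (hl : Tendsto (fun j : ℤ => ((j : ℝ))⁻¹) l (𝓝 0)) (hl0 : ∀ᶠ j in l, j ≠ 0) :
    Tendsto (fun j : ℤ => x j / (j : ℝ)) l (𝓝 ω) := by
  have h1 := (bdd_le_mul_tendsto_zero' M (Eventually.of_forall h) hl).const_add ω
  rw [add_zero] at h1
  refine h1.congr' ?_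
  filter_upwards [hl0] with j hj
  have : (j : ℝ) ≠ 0 := by exact_mod_cast hj
  field_simp
  ring

/-- Two lifts of the same sequence differ by a constant. -/
theorem IsLift.sub_eq {γ : ℝ → ℂ} (hγ : IsBilliard γ) {z : ℤ → ℂ} {x x' : ℤ → ℝ}
    (h : IsLift γ x z) (h' : IsLift γ x' z) (j : ℤ) : x' j - x j = x' 0 - x 0 := by
  have step : ∀ j, x' (j + 1) - x (j + 1) = x' j - x j := by
    intro j
    obtain ⟨a, ha⟩ := hγ.injective_mod_one (x' j) (x j) (by rw [h.1, h'.1])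
    obtain ⟨b, hb⟩ := hγ.injective_mod_one (x' (j + 1)) (x (j + 1)) (by rw [h.1, h'.1])
    have h1 := h.2 j
    have h2 := h'.2 j
    have h3 : ((b - a : ℤ) : ℝ) < 1 := by push_cast; linarith
    have h4 : (-1 : ℝ) < ((b - a : ℤ) : ℝ) := by push_cast; linarith
    have h5 : b - a < 1 := by exact_mod_cast h3
    have h6 : -1 < b - a := by exact_mod_cast h4
    rw [ha, hb, show a = b by omega]
  induction j using Int.induction_on with
  | zero => rfl
  | succ i ih => rw [step, ih]
  | pred i ih =>
    rw [← ih, ← step (-(i : ℤ) - 1), sub_add_cancel]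

theorem hasRotationNumber_of_bounded {γ : ℝ → ℂ} (hγ : IsBilliard γ) {z : ℤ → ℂ} {x : ℤ → ℝ}
    (h : IsLift γ x z) {ω M : ℝ} (hM : ∀ j, |x j - ω * j| ≤ M) : HasRotationNumber γ z ω := by
  intro x' hx'
  have hM' : ∀ j, |x' j - ω * j| ≤ M + |x' 0 - x 0| := by
    intro j
    rw [show x' j - ω * j = (x j - ω * j) + (x' j - x j) by ring, h.sub_eq hγ hx' j]
    exact (abs_add_le _ _).trans (by linarith [hM j])
  exact ⟨tendsto_div_of_bounded hM' (tendsto_inv_atTop_zero.comp tendsto_intCast_atTop_atTop)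
      (eventually_ne_atTop 0),
    tendsto_div_of_bounded hM'
      (tendsto_inv_atBot_zero.comp (tendsto_intCast_atBot_iff.mpr tendsto_id))
      (eventually_ne_atBot 0)⟩

/-! ### The billiard orbit -/

theorem IsFrame.sign_right {γ : ℝ → ℂ} {T₀ q T₁ q' : ℝ} (F : IsFrame γ T₀ q T₁ q') {r : ℝ}
    (hr : r ∈ Ioo (q' - 1) q) : SignType.sign (r - T₀) = SignType.sign (γ r).im := by
  rcases lt_trichotomy r T₀ with h | h | h
  · rw [← F.periodic r, sign_neg (by linarith),
      sign_neg (F.im_neg (r + 1) ⟨by linarith [hr.1, F.lt₃], by linarith⟩)]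
  · rw [h, F.im_zero, sub_self]
  · rw [sign_pos (by linarith), sign_pos (F.im_pos r ⟨h, by linarith [hr.2, F.lt₂]⟩)]

theorem IsFrame.sign_left {γ : ℝ → ℂ} {T₀ q T₁ q' : ℝ} (F : IsFrame γ T₀ q T₁ q') {r : ℝ}
    (hr : r ∈ Ioo q q') : SignType.sign (r - T₁) = SignType.sign (-(γ r).im) := by
  rcases lt_trichotomy r T₁ with h | h | h
  · rw [sign_neg (by linarith), sign_neg (by
      linarith [F.im_pos r ⟨by linarith [hr.1, F.lt₁], h⟩])]
  · rw [h, F.antipode, Complex.neg_im, F.im_zero, sub_self, neg_zero, neg_zero]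
  · rw [sign_pos (by linarith), sign_pos (by
      linarith [F.im_neg r ⟨h, by linarith [hr.2, F.lt₄]⟩])]

/-- On the right arc the cyclic order relative to a point of the left arc is the order of the
parameters. -/
theorem IsFrame.cyclicLE_iff {γ : ℝ → ℂ} {T₀ q T₁ q' : ℝ} (F : IsFrame γ T₀ q T₁ q') {a b c : ℝ}
    (ha : a ∈ Ioo (q' - 1) q) (hb : b ∈ Ioo (q' - 1) q) (hc : c ∈ Ioo q q') :
    CyclicLE γ (γ a) (γ b) (γ c) ↔ a ≤ b := by
  constructor
  · rintro ⟨u, v, w, hu, hv, hw, huv, hvw, hwu⟩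
    by_contra! hlt
    obtain ⟨i, hi⟩ := F.injective_mod_one u a hu
    obtain ⟨j, hj⟩ := F.injective_mod_one v b hv
    obtain ⟨k, hk⟩ := F.injective_mod_one w c hw
    have h1 : 0 < j - i := by
      have : (0 : ℝ) < ((j - i : ℤ) : ℝ) := by push_cast; linarith
      exact_mod_cast this
    have h2 : k - i < 1 := by
      have : ((k - i : ℤ) : ℝ) < 1 := by push_cast; linarith [ha.2, hc.1]
      exact_mod_cast this
    have h3 : (k : ℝ) ≤ j - 1 := by
      have : k ≤ j - 1 := by omega
      exact_mod_cast this
    linarith [hc.2, hb.1]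
  · intro hab
    exact ⟨a, b, c, rfl, rfl, rfl, hab, by linarith [hb.2, hc.1], by linarith [ha.1, hc.2]⟩

/-- The bent orbit of period `2 (2 m + 1)` around the orbit of period two on the horizontal
axis, whose lift is `X`. -/
theorem IsFrame.exists_orbit {γ : ℝ → ℂ} {T₀ q T₁ q' : ℝ} (F : IsFrame γ T₀ q T₁ q')
    {m : ℕ} (hm : 1 ≤ m)
    (hκ : curvature γ T₀ * (2 * (γ T₀).re) < 2 * Real.cos (Real.pi / (2 * m + 1)) ^ 2)
    {X : ℤ → ℝ} (hX : ∀ j, X j = (if Even j then T₀ else T₁) + (j / 2 : ℤ)) :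
    ∃ (z : ℤ → ℂ) (x : ℤ → ℝ), IsBilliardOrbit γ z ∧ IsLift γ x z ∧ ¬ IsBirkhoff γ z ∧
      HasMinimalPeriod z (2 * (2 * m + 1)) ∧ HasRotationNumber γ z (1 / 2) ∧
      CrossExactly (2 * (2 * m + 1)) (2 * m + 1) x X 4 ∧ (∀ j, conj (z j) = z (-j)) ∧
      ∀ j, -z j = z (2 * m + 1 + j) := by
  obtain ⟨y, hper, hneg, hmem, hre, hy0, him, hbal⟩ := F.exists_sequence hm hκ
  set z := alternate y with hz
  have horb : IsBilliardOrbit γ z := F.isBilliardOrbit_alternate hmem hre hbal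
  have hzconj : ∀ j, conj (z j) = z (-j) := by
    intro j
    by_cases hj : Even j
    · rw [hz, alternate_of_even y hj, alternate_of_even y hj.neg, hneg]
    · rw [hz, alternate_of_odd y hj, alternate_of_odd y (by simpa using hj), hneg, map_neg]
  have hzneg : ∀ j, -z j = z (2 * m + 1 + j) := by
    intro j
    have hy : y (2 * m + 1 + j) = y j := by simpa using hper 1 j
    have hodd : ¬ Even (2 * (m : ℤ) + 1) := by
      rw [Int.not_even_iff_odd]; exact ⟨m, rfl⟩
    by_cases hj : Even j
    · rw [hz, alternate_of_even y hj, alternate_of_odd y (by simp [Int.even_add, hj, hodd]), hy]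
    · rw [hz, alternate_of_odd y hj, alternate_of_even y (by simp [Int.even_add, hj, hodd]), hy,
        neg_neg]
  have hzper : ∀ j, z (2 * (2 * m + 1) + j) = z j := by
    intro j
    rw [show 2 * (2 * (m : ℤ) + 1) + j = 2 * m + 1 + (2 * m + 1 + j) by ring, ← hzneg, ← hzneg,
      neg_neg]
  -- signs of the heights, and recurrence to the axis
  have him0 : ∀ n : ℤ, (y ((2 * m + 1) * n)).im = 0 := by
    intro n
    have := hper n 0
    rw [add_zero] at this
    rw [this, hy0, F.im_zero]
  have himpos : ∀ (n : ℤ) (i : ℕ), 1 ≤ i → i ≤ m → 0 < (y ((2 * m + 1) * n + i)).im := by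
    intro n i h1 h2
    rw [hper]; exact him i h1 h2
  have himneg : ∀ (n : ℤ) (i : ℕ), 1 ≤ i → i ≤ m → (y ((2 * m + 1) * n + -i)).im < 0 := by
    intro n i h1 h2
    rw [hper, hneg, Complex.conj_im]
    linarith [him i h1 h2]
  have hdvd : ∀ j : ℤ, (y j).im = 0 → (2 * m + 1 : ℤ) ∣ j := by
    intro j hj
    obtain ⟨n, i, hi, h⟩ := exists_eq_mul_add_or_sub m j
    rcases Nat.eq_zero_or_pos i with rfl | hpos
    · exact ⟨n, by simpa using h⟩
    · rcases h with rfl | rfl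
      · exact absurd hj (himpos n i hpos hi).ne'
      · exact absurd hj (himneg n i hpos hi).ne
  have hret : ∀ j, z j = z 0 → (2 * (2 * m + 1) : ℤ) ∣ j := by
    intro j hj
    rw [hz, alternate_of_even y (j := 0) (by simp), hy0] at hj
    by_cases he : Even j
    · rw [alternate_of_even y he] at hj
      obtain ⟨n, rfl⟩ := hdvd j (by rw [hj, F.im_zero])
      have hodd : ¬ Even (2 * (m : ℤ) + 1) := by
        rw [Int.not_even_iff_odd]; exact ⟨m, rfl⟩
      obtain ⟨l, rfl⟩ : Even n := by simpa [Int.even_mul, hodd] using he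
      exact ⟨l, by ring⟩
    · rw [alternate_of_odd y he] at hj
      have h1 := congrArg Complex.re hj
      rw [Complex.neg_re] at h1
      linarith [hre j, F.re_pos_zero]
  -- the lift: even times on the right arc, odd times on the left arc
  have hex : ∀ j, ∃ r, γ r = z j ∧ (Even j → r ∈ Ioo (q' - 1) q) ∧ (¬ Even j → r ∈ Ioo q q') := by
    intro j
    by_cases hj : Even j
    · obtain ⟨r, hr, e⟩ := F.exists_right (hmem j) (hre j)
      exact ⟨r, by rw [e, hz, alternate_of_even y hj], fun _ => hr, fun h => absurd hj h⟩
    · obtain ⟨r, hr, e⟩ := F.exists_left (F.neg_mem _ (hmem j)) (by simpa using hre j)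
      exact ⟨r, by rw [e, hz, alternate_of_odd y hj], fun h => absurd h hj, fun _ => hr⟩
  choose r hγr hrE hrO using hex
  have hreq : ∀ i j, (Even i ↔ Even j) → z i = z j → r i = r j := by
    intro i j hp e
    rw [← hγr, ← hγr] at e
    by_cases hi : Even i
    · have h1 := hrE i hi
      have h2 := hrE j (hp.mp hi)
      exact F.eq_of_abs_sub_lt e (by linarith [h1.2, h2.1, F.lt₂, F.lt₃])
        (by linarith [h2.2, h1.1, F.lt₂, F.lt₃])
    · have h1 := hrO i hi
      have h2 := hrO j (fun h => hi (hp.mpr h))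
      exact F.eq_of_abs_sub_lt e (by linarith [h1.2, h2.1, F.lt₁, F.lt₄])
        (by linarith [h2.2, h1.1, F.lt₁, F.lt₄])
  set x : ℤ → ℝ := fun j => r j + (j / 2 : ℤ) with hx
  have hlift : IsLift γ x z := by
    refine ⟨fun j => by rw [hx, F.add_intCast, hγr], fun j => ?_⟩
    simp only [hx]
    by_cases hj : Even j
    · have h1 := hrE j hj
      have h2 := hrO (j + 1) (by simpa [Int.even_add_one] using hj)
      rw [show (j + 1) / 2 = j / 2 by obtain ⟨k, rfl⟩ := hj; omega]
      constructor <;> linarith [h1.1, h1.2, h2.1, h2.2]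
    · have h1 := hrO j hj
      have h2 := hrE (j + 1) (by simpa [Int.even_add_one] using hj)
      rw [show (j + 1) / 2 = j / 2 + 1 by
        obtain ⟨k, rfl⟩ := Int.not_even_iff_odd.mp hj; omega]
      push_cast
      constructor <;> linarith [h1.1, h1.2, h2.1, h2.2]
  have hsign : ∀ j, SignType.sign (x j - X j) = SignType.sign (y j).im := by
    intro j
    rw [hX, hx, add_sub_add_right_eq_sub]
    by_cases hj : Even j
    · rw [if_pos hj, F.sign_right (hrE j hj), hγr, hz, alternate_of_even y hj]
    · rw [if_neg hj, F.sign_left (hrO j hj), hγr, hz, alternate_of_odd y hj, Complex.neg_im,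
        neg_neg]
  have hd0 : ∀ n : ℤ, x ((2 * m + 1) * n) - X ((2 * m + 1) * n) = 0 := fun n => by
    rw [← sign_eq_zero_iff, hsign, sign_eq_zero_iff, him0]
  have hdpos : ∀ (n : ℤ) (i : ℕ), 1 ≤ i → i ≤ m →
      0 < x ((2 * m + 1) * n + i) - X ((2 * m + 1) * n + i) := fun n i h1 h2 => by
    rw [← sign_eq_one_iff, hsign, sign_eq_one_iff]
    exact himpos n i h1 h2
  have hdneg : ∀ (n : ℤ) (i : ℕ), 1 ≤ i → i ≤ m →
      x ((2 * m + 1) * n + -i) - X ((2 * m + 1) * n + -i) < 0 := fun n i h1 h2 => by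
    rw [← sign_eq_neg_one_iff, hsign, sign_eq_neg_one_iff]
    exact himneg n i h1 h2
  refine ⟨z, x, horb, hlift, ?_, ?_, ?_, ?_, hzconj, hzneg⟩
  · intro hB
    have hcyc : ∀ i j l, Even i → Even j → ¬ Even l →
        (CyclicLE γ (z i) (z j) (z l) ↔ r i ≤ r j) := by
      intro i j l hi hj hl
      rw [← hγr i, ← hγr j, ← hγr l]
      exact F.cyclicLE_iff (hrE i hi) (hrE j hj) (hrO l hl)
    -- two steps preserve the order of the points on the right arc
    have hshift : ∀ i j, Even i → Even j → r i ≤ r j → r (i + 2) ≤ r (j + 2) := by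
      intro i j hi hj h
      have h1 := hB i j 1 2 ((hcyc i j 1 hi hj (by decide)).mpr h)
      exact (hcyc _ _ _ (hi.add even_two) (hj.add even_two) (by decide)).mp h1
    have hend : r (2 * ((2 * m + 1 : ℕ) : ℤ)) = r 0 := by
      refine hreq _ _ (by simp) ?_
      have := hzper 0
      rw [add_zero] at this
      push_cast
      exact this
    have hnext : ∀ k : ℕ, (2 * (k : ℤ) + 2) = 2 * ((k + 1 : ℕ) : ℤ) := fun k => by push_cast; ring
    have hone : r (2 * ((1 : ℕ) : ℤ)) = r 0 := by
      rcases le_total (r 0) (r 2) with h | h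
      · have hmono : Monotone fun k : ℕ => r (2 * (k : ℤ)) := by
          refine monotone_nat_of_le_succ fun k => ?_
          induction k with
          | zero => simpa using h
          | succ k ih =>
            have := hshift _ _ (even_two_mul _) (even_two_mul _) ih
            rwa [hnext, hnext] at this
        refine le_antisymm ?_ (by simpa using h)
        rw [← hend]
        exact hmono (show 1 ≤ 2 * m + 1 by omega)
      · have hanti : Antitone fun k : ℕ => r (2 * (k : ℤ)) := by
          refine antitone_nat_of_succ_le fun k => ?_
          induction k with
          | zero => simpa using h
          | succ k ih =>
            have := hshift _ _ (even_two_mul _) (even_two_mul _) ih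
            rwa [hnext, hnext] at this
        refine le_antisymm (by simpa using h) ?_
        rw [← hend]
        exact hanti (show 1 ≤ 2 * m + 1 by omega)
    have h2 : z 2 = z 0 := by
      rw [← hγr, ← hγr, ← hone]
      norm_num
    have := Int.le_of_dvd (by norm_num) (hret 2 h2)
    omega
  · refine ⟨⟨by omega, fun j => ?_⟩, fun k hk => ?_⟩
    · rw [add_comm]
      push_cast
      exact hzper j
    · have h1 := hk.2 0
      rw [zero_add] at h1
      have h2 := Int.le_of_dvd (by exact_mod_cast hk.1) (hret k h1)
      omega
  · refine hasRotationNumber_of_bounded F.toIsBilliard hlift (M := |q'| + |q' - 1| + 1) fun j => ?_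
    have hr : q' - 1 ≤ r j ∧ r j ≤ q' := by
      by_cases hj : Even j
      · have := hrE j hj
        exact ⟨this.1.le, by linarith [this.2, F.lt₂, F.lt₃]⟩
      · have := hrO j hj
        exact ⟨by linarith [this.1, F.lt₁, F.lt₄], this.2.le⟩
    have h1 : (2 : ℝ) * (j / 2 : ℤ) ≤ j := by
      have : 2 * (j / 2) ≤ j := by omega
      exact_mod_cast this
    have h2 : (j : ℝ) ≤ 2 * (j / 2 : ℤ) + 1 := by
      have : j ≤ 2 * (j / 2) + 1 := by omega
      exact_mod_cast this
    simp only [hx]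
    rw [abs_le]
    constructor <;> linarith [neg_abs_le (q' - 1), le_abs_self q', abs_nonneg q',
      abs_nonneg (q' - 1)]
  · have hperiod : ∀ j : ℤ, (((2 * (2 * m + 1) : ℕ) : ℤ) + j) / 2 = j / 2 + (2 * m + 1) := by
      intro j; push_cast; omega
    have heven : ∀ j : ℤ, Even (((2 * (2 * m + 1) : ℕ) : ℤ) + j) ↔ Even j := by
      intro j; push_cast; simp [Int.even_add]
    refine ⟨fun j => ?_, fun j => ?_, fun j hj => ?_, ?_⟩
    · simp only [hx]
      rw [hperiod, hreq _ j (heven j) (by push_cast; exact hzper j)]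
      push_cast
      ring
    · rw [hX, hX, hperiod]
      simp only [heven]
      push_cast
      ring
    · have h0 : (y j).im = 0 := by
        rw [← sign_eq_zero_iff, ← hsign, hj, sub_self, sign_zero]
      obtain ⟨n, rfl⟩ := hdvd j h0
      have h1 := hdneg n 1 le_rfl hm
      have h2 := hdpos n 1 le_rfl hm
      push_cast at h1 h2
      rw [← sub_eq_add_neg] at h1
      exact mul_neg_of_neg_of_pos h1 h2
    · have := isGreatest_signChanges (d := fun j => x j - X j) hm hd0 hdpos hdneg
      push_cast
      exact this

/-! ### Normalisation -/

/-- A point on one of the coordinate axes is turned onto the positive horizontal axis by a rotation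
that either commutes with complex conjugation or turns it into the other reflection. -/
theorem exists_rotation_to_axis {w : ℂ} (h0 : w ≠ 0) (hw : conj w = w ∨ conj w = -w) :
    ∃ g : ℂ ≃ₗᵢ[ℝ] ℂ, (g w).im = 0 ∧ 0 < (g w).re ∧
      ((∀ v, g (conj v) = conj (g v)) ∨ ∀ v, g (conj v) = -conj (g v)) := by
  have hn : (‖w‖ : ℂ) ≠ 0 := by simpa using h0
  have hn' : 0 < ‖w‖ := norm_pos_iff.mpr h0
  let e : Circle := ⟨conj w / ‖w‖, by simp [Submonoid.unitSphere, h0]⟩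
  have he : ∀ v, rotation e v = conj w / ‖w‖ * v := fun v => rfl
  have hgw : rotation e w = ‖w‖ := by
    rw [he, div_mul_eq_mul_div, mul_comm, Complex.mul_conj, Complex.normSq_eq_norm_sq]
    push_cast
    field_simp
  refine ⟨rotation e, by rw [hgw, Complex.ofReal_im], by rwa [hgw, Complex.ofReal_re], ?_⟩
  rcases hw with hw | hw
  · left
    intro v
    rw [he, he, map_mul, map_div₀, Complex.conj_conj, Complex.conj_ofReal, hw]
  · right
    intro v
    rw [he, he, map_mul, map_div₀, Complex.conj_conj, Complex.conj_ofReal, hw]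
    ring

theorem IsBisymmetric.map {γ : ℝ → ℂ} (h : IsBisymmetric γ) {g : ℂ ≃ₗᵢ[ℝ] ℂ}
    (hg : (∀ v, g (conj v) = conj (g v)) ∨ ∀ v, g (conj v) = -conj (g v)) :
    IsBisymmetric (fun t => g (γ t)) := by
  have hneg : ∀ w ∈ range (fun t => g (γ t)), -w ∈ range (fun t => g (γ t)) := by
    rintro _ ⟨t, rfl⟩
    obtain ⟨t', ht'⟩ := h.neg_mem _ ⟨t, rfl⟩
    exact ⟨t', by simp [ht']⟩
  refine ⟨h.toIsBilliard.map g, hneg, ?_⟩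
  rintro _ ⟨t, rfl⟩
  obtain ⟨t', ht'⟩ := h.conj_mem _ ⟨t, rfl⟩
  rcases hg with hg | hg
  · exact ⟨t', by simp only [ht', hg]⟩
  · have := hneg _ ⟨t', rfl⟩
    simp only [ht', hg, neg_neg] at this
    exact this

/-- After an isometry of the plane, an antipodal pair of points on a coordinate axis lies on the
horizontal axis, and the curve runs counterclockwise. -/
theorem IsBisymmetric.exists_normalisation {γ : ℝ → ℂ} (h : IsBisymmetric γ) {T₀ T₁ : ℝ}
    (h1 : T₀ < T₁) (h2 : T₁ < T₀ + 1) (hanti : γ T₁ = -γ T₀)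
    (haxis : conj (γ T₀) = γ T₀ ∨ conj (γ T₀) = -γ T₀) :
    ∃ (g : ℂ ≃ₗᵢ[ℝ] ℂ) (q q' : ℝ), IsFrame (fun t => g (γ t)) T₀ q T₁ q' ∧
      ((∀ v, g (conj v) = conj (g v)) ∨ ∀ v, g (conj v) = -conj (g v)) := by
  obtain ⟨g, him, hre, hg⟩ := exists_rotation_to_axis (h.ne_zero T₀) haxis
  have hb := h.map hg
  have hanti' : g (γ T₁) = -g (γ T₀) := by rw [hanti, map_neg]
  by_cases hup : ∃ t ∈ Ioo T₀ T₁, 0 < (g (γ t)).im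
  · obtain ⟨q, q', F⟩ := hb.exists_isFrame h1 h2 him hre hanti' hup
    exact ⟨g, q, q', F, hg⟩
  · push Not at hup
    have hmid : (T₀ + T₁) / 2 ∈ Ioo T₀ T₁ := ⟨by linarith, by linarith⟩
    have hdown : (g (γ ((T₀ + T₁) / 2))).im < 0 := by
      refine lt_of_le_of_ne (hup _ hmid) fun e => ?_
      rcases hb.eq_or_eq_neg_of_im him e with e | e
      · have := hb.eq_of_abs_sub_lt e (by linarith) (by linarith)
        linarith
      · rw [← hanti'] at e
        have := hb.eq_of_abs_sub_lt e (by linarith) (by linarith)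
        linarith
    have hg' : (∀ v, g.trans Complex.conjLIE (conj v) = conj (g.trans Complex.conjLIE v)) ∨
        ∀ v, g.trans Complex.conjLIE (conj v) = -conj (g.trans Complex.conjLIE v) := by
      rcases hg with hg | hg
      · exact Or.inl fun v => by simp [hg]
      · exact Or.inr fun v => by simp [hg]
    obtain ⟨q, q', F⟩ := (h.map hg').exists_isFrame h1 h2 (by simpa using him) (by simpa using hre)
      (by simp [hanti]) ⟨_, hmid, by simpa using hdown⟩
    exact ⟨_, q, q', F, hg'⟩

/-! ### Symmetric sequences -/

theorem IsBilliard.curvature_add_intCast {γ : ℝ → ℂ} (h : IsBilliard γ) (t : ℝ) (n : ℤ) :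
    curvature γ (t + n) = curvature γ t := by
  have key : ∀ f : ℝ → ℂ, (∀ s, f (s + n) = f s) → ∀ s, deriv f (s + n) = deriv f s := by
    intro f hf s
    rw [← deriv_comp_add_const f n s]
    simp only [hf]
  have h1 := key γ fun s => h.add_intCast s n
  rw [curvature, curvature, key _ h1, h1]

theorem HasMinimalPeriod.eq_of_reflection {z : ℤ → ℂ} {p : ℕ} (h : HasMinimalPeriod z p) {k l : ℤ}
    (hk : 0 ≤ k ∧ k < p) (hl : 0 ≤ l ∧ l < p) (e : ∀ i, z (k - i) = z (l - i)) : k = l := by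
  have key : ∀ {k l : ℤ}, (0 ≤ k ∧ k < p) → (0 ≤ l ∧ l < p) → (∀ i, z (k - i) = z (l - i)) →
      ¬ k < l := by
    intro k l hk hl e hlt
    have hper : HasPeriod z (l - k).toNat := by
      intro i
      rw [Int.toNat_of_nonneg (by omega)]
      have := e (k - i)
      rw [sub_sub_cancel] at this
      rw [this]
      congr 1
      ring
    have := h.2 (show (l - k).toNat ∈ {k : ℕ | 0 < k ∧ HasPeriod z k} from ⟨by omega, hper⟩)
    omega
  rcases lt_trichotomy k l with h1 | h1 | h1
  · exact absurd h1 (key hk hl e)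
  · exact h1
  · exact absurd h1 (key hl hk fun i => (e i).symm)

/-- The two possible ways in which the reflections act on a sequence on which the rotation acts as
the shift over half a period. -/
theorem isSymmetricSeq_and_isTypeI {z : ℤ → ℂ} {s : ℕ} (hs : 0 < s)
    (hmin : HasMinimalPeriod z (2 * s)) (hneg : ∀ j, -z j = z (s + j))
    (hconj : (∀ j, conj (z j) = z (-j)) ∨ ∀ j, -conj (z j) = z (-j)) :
    IsSymmetricSeq 2 z ∧ IsTypeI (2 * s) z := by
  obtain ⟨k₁, k₂, hk₁, hk₂, h1, h2⟩ : ∃ k₁ k₂ : ℤ, (0 ≤ k₁ ∧ k₁ < (2 * s : ℕ)) ∧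
      (0 ≤ k₂ ∧ k₂ < (2 * s : ℕ)) ∧ (∀ j, conj (z j) = z (k₁ - j)) ∧
      ∀ j, -conj (z j) = z (k₂ - j) := by
    rcases hconj with h | h
    · exact ⟨0, s, by omega, by omega, fun j => by rw [h, zero_sub], fun j => by
        rw [h, hneg, sub_eq_add_neg]⟩
    · exact ⟨s, 0, by omega, by omega, fun j => by
        rw [sub_eq_add_neg, ← hneg, ← h, neg_neg], fun j => by rw [h, zero_sub]⟩
  refine ⟨fun g hg => ?_, even_two_mul s, fun j => ?_, fun σ hσ => ?_⟩
  · rcases dihedral_two_apply hg with hg | hg | hg | hg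
    · exact Or.inl ⟨0, fun j => by rw [hg, zero_add]⟩
    · exact Or.inl ⟨s, fun j => by rw [hg, hneg]⟩
    · exact Or.inr ⟨k₁, fun j => by rw [hg, h1]⟩
    · exact Or.inr ⟨k₂, fun j => by rw [hg, h2]⟩
  · rw [rot_two_apply, hneg, Nat.mul_div_cancel_left s two_pos]
  · obtain ⟨k, hk, h⟩ : ∃ k : ℤ, (0 ≤ k ∧ k < (2 * s : ℕ)) ∧ ∀ j, σ (z j) = z (k - j) := by
      rcases hσ with rfl | rfl
      · exact ⟨k₁, hk₁, h1⟩
      · refine ⟨k₂, hk₂, fun j => ?_⟩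
        rw [← h2]
        exact rot_two_apply _
    exact ⟨k, ⟨hk, h⟩, fun l hl => hmin.eq_of_reflection hl.1 hk fun i => by rw [← hl.2, h]⟩

end Billiard

end

theorem mainTheorem7
    (γ : ℝ → ℂ) (hγ : Billiard.IsBilliard γ) (hsym : Billiard.IsSymmetricCurve 2 γ)
    (Z : ℤ → ℂ) (X : ℤ → ℝ) (hZ : Billiard.IsBilliardOrbit γ Z) (hX : Billiard.IsLift γ X Z)
    (hZper : Billiard.HasPeriod Z 2) (hZBirkhoff : Billiard.IsBirkhoff γ Z)
    (hZsym : Billiard.IsSymmetricSeq 2 Z) :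
    (∀ i : ℤ, ‖Z (i + 1) - Z i‖ = ‖Z 1 - Z 0‖ ∧
      Billiard.curvature γ (X i) = Billiard.curvature γ (X 0)) ∧
    ∀ s p : ℕ, 3 ≤ s → Odd s → p = 2 * s →
      Billiard.curvature γ (X 0) * ‖Z 1 - Z 0‖ < 2 * Real.cos (2 * Real.pi / p) ^ 2 →
      ∃ (z : ℤ → ℂ) (x : ℤ → ℝ),
        Billiard.IsBilliardOrbit γ z ∧ Billiard.IsLift γ x z ∧
        Billiard.IsSymmetricSeq 2 z ∧ ¬ Billiard.IsBirkhoff γ z ∧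
        Billiard.IsTypeI p z ∧ Billiard.HasMinimalPeriod z p ∧
        Billiard.HasRotationNumber γ z (1 / 2) ∧
        Billiard.CrossExactly p s x X 4 := by
  open Billiard ComplexConjugate in
  have hneg : ∀ w ∈ range γ, -w ∈ range γ := fun w hw => by
    rw [← hsym _ (rot_mem_dihedral 2)]
    exact ⟨w, hw, rot_two_apply w⟩
  have hconj : ∀ w ∈ range γ, conj w ∈ range γ := fun w hw => by
    rw [← hsym _ (refl_mem_dihedral 2)]
    exact ⟨w, hw, refl_apply w⟩
  have hb : IsBisymmetric γ := ⟨hγ, hneg, hconj⟩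
  have hZeven : ∀ n : ℤ, Z (2 * n) = Z 0 := by
    intro n
    have hp : Function.Periodic Z 2 := hZper
    simpa [mul_comm] using hp.int_mul n 0
  have hZodd : ∀ n : ℤ, Z (2 * n + 1) = Z 1 := by
    intro n
    have hp : Function.Periodic Z 2 := hZper
    simpa [mul_comm, add_comm] using hp.int_mul n 1
  have hZ01 : ∀ k : ℤ, Z k = Z 0 ∨ Z k = Z 1 := by
    intro k
    rcases Int.even_or_odd' k with ⟨n, rfl | rfl⟩
    · exact Or.inl (hZeven n)
    · exact Or.inr (hZodd n)
  have horbit : ∀ h ∈ dihedral 2, h (Z 0) = Z 0 ∨ h (Z 0) = Z 1 := by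
    intro h hh
    rcases hZsym h hh with ⟨k, hk⟩ | ⟨k, hk⟩ <;> · rw [hk 0]; exact hZ01 _
  have hX0 : γ (X 0) = Z 0 := hX.1 0
  have hZ0 : Z 0 ≠ 0 := by rw [← hX0]; exact hb.ne_zero _
  have hZ1 : Z 1 = -Z 0 := by
    have := horbit _ (rot_mem_dihedral 2)
    rw [rot_two_apply] at this
    rcases this with e | e
    · exact absurd (neg_eq_self.mp e) hZ0
    · exact e.symm
  have haxis : conj (γ (X 0)) = γ (X 0) ∨ conj (γ (X 0)) = -γ (X 0) := by
    have := horbit _ (refl_mem_dihedral 2)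
    rwa [refl_apply, hZ1, ← hX0] at this
  have hX1 : X 0 < X 1 ∧ X 1 < X 0 + 1 := by
    have := hX.2 0
    rw [zero_add] at this
    constructor <;> linarith
  -- two steps of a lift of the orbit of period two make one turn
  have hX2 : ∀ j, X (j + 2) = X j + 1 := by
    intro j
    have e : γ (X (j + 2)) = γ (X j) := by rw [hX.1, hX.1]; exact hZper j
    have h1 := hX.2 j
    have h2 := hX.2 (j + 1)
    rw [add_assoc, one_add_one_eq_two] at h2
    have := hb.eq_of_abs_sub_lt (e.trans (hb.periodic (X j)).symm) (by linarith) (by linarith)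
    exact this
  have hXform : ∀ j, X j = (if Even j then X 0 else X 1) + (j / 2 : ℤ) := by
    have hE : ∀ n : ℤ, X (2 * n) = X 0 + n ∧ X (2 * n + 1) = X 1 + n := by
      intro n
      induction n using Int.induction_on with
      | zero => simp
      | succ i ih =>
        have h1 := hX2 (2 * i)
        have h2 := hX2 (2 * i + 1)
        rw [show (2 : ℤ) * (i + 1) = 2 * i + 2 by ring,
          show (2 : ℤ) * i + 2 + 1 = 2 * i + 1 + 2 by ring, h1, h2, ih.1, ih.2]
        push_cast
        constructor <;> ring
      | pred i ih =>
        have h1 := hX2 (2 * (-i - 1))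
        have h2 := hX2 (2 * (-i - 1) + 1)
        rw [show (2 : ℤ) * (-i - 1) + 2 = 2 * -i by ring, ih.1] at h1
        rw [show (2 : ℤ) * (-i - 1) + 1 + 2 = 2 * -i + 1 by ring, ih.2] at h2
        push_cast at h1 h2 ⊢
        constructor <;> linarith
    intro j
    rcases Int.even_or_odd' j with ⟨n, rfl | rfl⟩
    · rw [(hE n).1, if_pos (even_two_mul n)]
      congr 2
      omega
    · rw [(hE n).2, if_neg (by rw [Int.not_even_iff_odd]; exact ⟨n, rfl⟩)]
      congr 2
      omega
  obtain ⟨g, q, q', F, hg⟩ := hb.exists_normalisation hX1.1 hX1.2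
    (by rw [hX.1, hX0, hZ1]) haxis
  have hcurv : curvature γ (X 1) = curvature γ (X 0) := by
    rw [← curvature_map γ g, ← curvature_map γ g]
    exact F.curvature_antipode
  refine ⟨fun i => ⟨?_, ?_⟩, ?_⟩
  · rcases Int.even_or_odd' i with ⟨n, rfl | rfl⟩
    · rw [hZeven, hZodd]
    · rw [hZodd, add_assoc, one_add_one_eq_two, show 2 * n + 2 = 2 * (n + 1) by ring, hZeven,
        norm_sub_rev]
  · rw [hXform i, hb.curvature_add_intCast]
    split_ifs
    · rfl
    · exact hcurv
  · rintro s p hs ⟨m, rfl⟩ rfl hκ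
    have hlen : ‖Z 1 - Z 0‖ = 2 * (g (γ (X 0))).re := by
      rw [hZ1, ← hX0, show -γ (X 0) - γ (X 0) = -(2 * γ (X 0)) by ring, norm_neg, norm_mul,
        ← g.norm_map (γ (X 0)), ← Complex.abs_re_eq_norm.mpr F.im_zero, abs_of_pos F.re_pos_zero]
      simp
    obtain ⟨z, x, hz, hx, hB, hmin, hrot, hcross, hzc, hzn⟩ := F.exists_orbit (m := m) (by omega)
      (by
        -- `2 π / p = π / (2 m + 1)`
        rw [curvature_map, ← hlen]
        convert hκ using 4
        push_cast
        field_simp) hXform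
    -- transport back to the original curve
    have hback : (fun t => g.symm (g (γ t))) = γ := by
      funext t
      exact g.symm_apply_apply _
    have hmin' : HasMinimalPeriod (fun j => g.symm (z j)) (2 * (2 * m + 1)) :=
      (hasMinimalPeriod_map_iff g.symm).mpr hmin
    have hzn' : ∀ j, -g.symm (z j) = g.symm (z ((2 * m + 1 : ℕ) + j)) := by
      intro j
      rw [← map_neg, hzn]
      push_cast
      rfl
    have hzc' : (∀ j, conj (g.symm (z j)) = g.symm (z (-j))) ∨
        ∀ j, -conj (g.symm (z j)) = g.symm (z (-j)) := by
      rcases hg with hg | hg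
      · refine Or.inl fun j => ?_
        rw [← hzc, LinearIsometryEquiv.eq_symm_apply, hg, g.apply_symm_apply]
      · refine Or.inr fun j => ?_
        rw [← hzc, LinearIsometryEquiv.eq_symm_apply, map_neg, hg, g.apply_symm_apply, neg_neg]
    obtain ⟨h1, h2⟩ := isSymmetricSeq_and_isTypeI (by omega) hmin' hzn' hzc'
    have hz' := hz.map g.symm
    have hx' := (isLift_map_iff g.symm).mpr hx
    have hB' := (isBirkhoff_map_iff (γ := fun t => g (γ t)) (z := z) g.symm).not.mpr hB
    have hrot' := (hasRotationNumber_map_iff g.symm).mpr hrot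
    rw [hback] at hz' hx' hB' hrot'
    exact ⟨_, x, hz', hx', h1, hB', h2, hmin', hrot', hcross⟩
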